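/- Let $b\in\mathcal S(\mathbb C)$ satisfy $b(1/\bar\lambda)=b(\lambda)$ and $b(-1/\bar\lambda)=\overline{b(\lambda)}$ for $\lambda\neq0$, and $\partial_\lambda^m\partial_{\bar\lambda}^n b(\lambda)=0$ for all $|\lambda|=1$ and all $m,n\ge 0$. Put $r(\lambda)=\pi\,\mathrm{sgn}(\lambda\bar\lambda-1)\,b(\lambda)/\bar\lambda$ and $$S(u,\zeta)=-\tfrac12\Big(\bar\zeta u+\zeta\bar u+\frac u\zeta+\frac{\bar u}{\bar\zeta}\Big)+\zeta^3+\bar\zeta^3+\frac1{\zeta^3}+\frac1{\bar\zeta^3}.$$ For $z\in\mathbb C$, $t\in\mathbb R\setminus\{0\}$ and $u=z/t$ define $$(A_{z,t}f)(\lambda)=-\frac1\pi\iint_{\mathbb C}\frac{r(\zeta)e^{itS(u,\zeta)}\overline{f(\zeta)}}{\zeta-\lambda}\,d\Re\zeta\,d\Im\zeta,\qquad B_{z,t}\cdot f=\iint_{\mathbb C}r(\zeta)e^{itS(u,\zeta)}\overline{f(\zeta)}\,d\Re\zeta\,d\Im\zeta .$$ Then, for every $n\ge0$, the integrals defining $A_{z,t}\cdot(A_{z,t}^n\cdot1)$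 and $B_{z,t}\cdot(A_{z,t}^n\cdot 1)$ converge absolutely, and: (a) $|B_{z,t}\cdot1|=O(\ln|t|/|t|)$ as $|t|\to\infty$, uniformly in $u\in\mathbb C$; (b) $|B_{z,t}\cdot A_{z,t}\cdot1|=O(\ln|t|/|t|)$ as $|t|\to\infty$, uniformly in $u\in\mathbb C$; and there is a constant $\beta>0$, independent of $u$, $\lambda$, $t$ and $n$, such that for all $|t|\ge1$ and all $u,\lambda\in\mathbb C$ (c) $|(A_{z,t}^2\cdot1)(\lambda)|\le\beta\,|t|^{-1/14}$; (d) $|(A_{z,t}^n\cdot1)(\lambda)|\le\beta^{n-1}|t|^{-\lfloor n/2\rfloor/14}$ for all $n\ge2$; (e) $|B_{z,t}\cdot A_{z,t}^{n-1}\cdot1|\le\dfrac{\beta^{n-1}\ln(3+|t|)}{|t|^{1+\lfloor(n-2)/2\rfloor/14}}$ for all $n\ge2$. Moreover, there is $T\ge1$ such that the Neumann series $\sum_{k\ge0}A_{z,t}^{2k}(1+A_{z,t}\cdot1)(\lambda)$ converges uniformly in $z,\lambda\in\mathbb C$ and $|t|\ge T$. -/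

import Mathlib

open MeasureTheory Filter
open scoped ComplexConjugate

noncomputable section

/-- The Wirtinger derivative `∂f/∂ζ = (∂f/∂x - i ∂f/∂y) / 2`. -/
def wirtinger (f : ℂ → ℂ) (ζ : ℂ) : ℂ :=
  (fderiv ℝ f ζ 1 - Complex.I * fderiv ℝ f ζ Complex.I) / 2

/-- The Wirtinger derivative `∂f/∂ζ̄ = (∂f/∂x + i ∂f/∂y) / 2`. -/
def wirtingerBar (f : ℂ → ℂ) (ζ : ℂ) : ℂ :=
  (fderiv ℝ f ζ 1 + Complex.I * fderiv ℝ f ζ Complex.I) / 2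

/-- The conditions on a Schwartz function `b` on `ℂ` (the scattering data at time `0`):
the two symmetries under `ζ ↦ 1 / ζ̄` and `ζ ↦ -1 / ζ̄`, and the vanishing of `b` together with
all its derivatives on the unit circle. -/
structure IsTransparentScatteringData (b : SchwartzMap ℂ ℂ) : Prop where
  symm_inv : ∀ ζ : ℂ, ζ ≠ 0 → b (1 / conj ζ) = b ζ
  symm_neg_inv : ∀ ζ : ℂ, ζ ≠ 0 → b (-1 / conj ζ) = conj (b ζ)
  deriv_eq_zero : ∀ (m n : ℕ) (ζ : ℂ), ‖ζ‖ = 1 →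
    (wirtinger^[m] (wirtingerBar^[n] (fun w => b w))) ζ = 0

/-- `r(ζ) = π sgn(ζ ζ̄ - 1) b(ζ) / ζ̄`. -/
def scatR (b : SchwartzMap ℂ ℂ) (ζ : ℂ) : ℂ :=
  (Real.pi : ℂ) * ((Real.sign (Complex.normSq ζ - 1) : ℝ) : ℂ) / conj ζ * b ζ

/-- The phase `S(u, ζ)`. It takes real values. -/
def phaseS (u ζ : ℂ) : ℂ :=
  -(1 / 2) * (conj ζ * u + ζ * conj u + u / ζ + conj u / conj ζ)
    + (ζ ^ 3 + conj ζ ^ 3 + 1 / ζ ^ 3 + 1 / conj ζ ^ 3)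

/-- The oscillating weight `r(ζ) exp(i t S(u, ζ))`, where `u = z / t`. -/
def oscWeight (b : SchwartzMap ℂ ℂ) (z : ℂ) (t : ℝ) (ζ : ℂ) : ℂ :=
  scatR b ζ * Complex.exp (Complex.I * (t : ℂ) * phaseS (z / (t : ℂ)) ζ)

/-- The operator `A_{z,t}`, integrating against Lebesgue measure on `ℂ`. -/
def opA (b : SchwartzMap ℂ ℂ) (z : ℂ) (t : ℝ) (f : ℂ → ℂ) (l : ℂ) : ℂ :=
  -(1 / (Real.pi : ℂ)) * ∫ ζ : ℂ, oscWeight b z t ζ * conj (f ζ) / (ζ - l)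

/-- The functional `B_{z,t}`, integrating against Lebesgue measure on `ℂ`. -/
def opB (b : SchwartzMap ℂ ℂ) (z : ℂ) (t : ℝ) (f : ℂ → ℂ) : ℂ :=
  ∫ ζ : ℂ, oscWeight b z t ζ * conj (f ζ)

/-- The function `A_{z,t}ⁿ · 1`. -/
def powA (b : SchwartzMap ℂ ℂ) (z : ℂ) (t : ℝ) (n : ℕ) : ℂ → ℂ :=
  (opA b z t)^[n] (fun _ => 1)

end

/-! The basic estimate is a two-dimensional stationary phase bound of size `log |t| / |t|`, uniform
in `u`, which uses only bounds on the amplitude and on its `∂/∂ζ` derivative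
(`exists_oscillatory_bound`). Off the origin, `ζ⁴ ∂S/∂ζ` is a cubic in `ζ²` whose coefficients make
its roots symmetric under `x ↦ 1 / x̄`. Hence one root lies on the unit circle and the other two
satisfy `|b| ≤ 1 ≤ |c|` (`exists_roots`). On each side of the circle two of the three factors are
then at least `||ζ|² - 1|`, so `∂S/∂ζ` behaves like a function with simple zeros, up to powers of
`circWeight` (`exists_stationary_points`). However the stationary points collide, this loss is
harmless: `r` and its first derivatives beat every power of `circWeight`, by Schwartz decay,
inversion symmetry and infinite-order vanishing on the circle (`exists_scat_bound`).

Instead of excising discs around the stationary points, one integrates by parts once over the whole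
plane, with `1 / ∂S/∂ζ` replaced by `χ = conj(∂S/∂ζ) / (|∂S/∂ζ|² + δ²)` and `δ = |t|^(-1/2)`
(`integral_oscWeight_eq`). What remains is `|t|⁻¹` times an integrable weight times `1 + 1 / (v (v +
δ))`, where `v` is the distance to the nearest stationary point. Its integral is logarithmic in `δ`.

For `B A f` with `f` merely bounded, the amplitude `conj (A f)` is a Cauchy transform with kernel `1
/ x̄`. Its `∂/∂ζ̄` derivative is a singular integral, but its `∂/∂ζ` derivative is formally just a
bounded function, and only the latter is needed. Smoothing the kernel at scale `κ` makes this
rigorous, with uniform error of order `κ log (1/κ)` for small `κ` (`exists_regularization`). For `A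
A f` the outer kernel `1 / (ζ - λ)` is smoothed as well. This costs `κ⁻²` in the derivative, and `κ
= |t|^(-1/4)` gives `|t|^(-1/4) log |t|`, which is stronger than `|t|^(-1/14)`
(`exists_opA_opA_bound`). These are sup-norm bounds valid for every bounded measurable `f`, so the
estimates on all powers and the Neumann series follow by iterating `A²`. -/

/-! ### Wirtinger calculus on the plane. -/

/-- The real-linear map `v ↦ a v + b v̄`. -/
noncomputable def wirtCLM (a b : ℂ) : ℂ →L[ℝ] ℂ :=
  a • ContinuousLinearMap.id ℝ ℂ + b • (Complex.conjCLE : ℂ →L[ℝ] ℂ)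

@[simp] lemma wirtCLM_apply (a b v : ℂ) : wirtCLM a b v = a * v + b * conj v := by
  simp [wirtCLM]

/-- `df = a dζ + b dζ̄` at the point `ζ`. -/
def HasWirt (f : ℂ → ℂ) (a b ζ : ℂ) : Prop := HasFDerivAt f (wirtCLM a b) ζ

lemma clm_eq_wirtCLM (L : ℂ →L[ℝ] ℂ) :
    L = wirtCLM ((L 1 - Complex.I * L Complex.I) / 2) ((L 1 + Complex.I * L Complex.I) / 2) := by
  ext v
  have hv : v = v.re • (1 : ℂ) + v.im • Complex.I := by
    simp [Complex.re_add_im]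
  have h1 : L v = v.re • L 1 + v.im • L Complex.I := by
    conv_lhs => rw [hv]
    rw [map_add, map_smul, map_smul]
  have h2 : conj v = (v.re : ℂ) - v.im * Complex.I := by
    apply Complex.ext <;> simp
  rw [h1, wirtCLM_apply, h2]
  nth_rewrite 3 [← Complex.re_add_im v]
  simp only [Complex.real_smul]
  linear_combination ((v.im : ℂ) * L Complex.I) * Complex.I_sq

lemma norm_wirtCLM_le (a b : ℂ) : ‖wirtCLM a b‖ ≤ ‖a‖ + ‖b‖ := by
  refine ContinuousLinearMap.opNorm_le_bound _ (by positivity) fun v => ?_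
  rw [wirtCLM_apply]
  refine (norm_add_le _ _).trans ?_
  simp [add_mul]

lemma HasWirt.wirtinger_eq {f : ℂ → ℂ} {a b ζ : ℂ} (h : HasWirt f a b ζ) :
    wirtinger f ζ = a := by
  rw [wirtinger, HasFDerivAt.fderiv h]
  simp only [wirtCLM_apply, map_one, Complex.conj_I]
  linear_combination ((b - a) / 2) * Complex.I_sq

lemma DifferentiableAt.hasWirt {f : ℂ → ℂ} {ζ : ℂ} (h : DifferentiableAt ℝ f ζ) :
    HasWirt f (wirtinger f ζ) (wirtingerBar f ζ) ζ := by
  rw [HasWirt, wirtinger, wirtingerBar, ← clm_eq_wirtCLM]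
  exact h.hasFDerivAt

lemma norm_wirtinger_le (f : ℂ → ℂ) (ζ : ℂ) : ‖wirtinger f ζ‖ ≤ ‖fderiv ℝ f ζ‖ := by
  have h1 := (fderiv ℝ f ζ).le_opNorm 1
  have h2 := (fderiv ℝ f ζ).le_opNorm Complex.I
  simp only [norm_one, mul_one, Complex.norm_I] at h1 h2
  have := norm_sub_le (fderiv ℝ f ζ 1) (Complex.I * fderiv ℝ f ζ Complex.I)
  rw [norm_mul, Complex.norm_I, one_mul] at this
  rw [wirtinger, norm_div, RCLike.norm_ofNat]
  linarith

lemma norm_wirtingerBar_le (f : ℂ → ℂ) (ζ : ℂ) : ‖wirtingerBar f ζ‖ ≤ ‖fderiv ℝ f ζ‖ := by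
  have h1 := (fderiv ℝ f ζ).le_opNorm 1
  have h2 := (fderiv ℝ f ζ).le_opNorm Complex.I
  simp only [norm_one, mul_one, Complex.norm_I] at h1 h2
  have := norm_add_le (fderiv ℝ f ζ 1) (Complex.I * fderiv ℝ f ζ Complex.I)
  rw [norm_mul, Complex.norm_I, one_mul] at this
  rw [wirtingerBar, norm_div, RCLike.norm_ofNat]
  linarith

lemma HasWirt.congr_coeff {f : ℂ → ℂ} {a b a' b' ζ : ℂ} (h : HasWirt f a b ζ)
    (ha : a = a') (hb : b = b') : HasWirt f a' b' ζ := ha ▸ hb ▸ h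

lemma HasWirt.congr_of_eventuallyEq {f g : ℂ → ℂ} {a b ζ : ℂ} (h : HasWirt f a b ζ)
    (hg : g =ᶠ[nhds ζ] f) : HasWirt g a b ζ :=
  HasFDerivAt.congr_of_eventuallyEq h hg

lemma HasDerivAt.hasWirt {f : ℂ → ℂ} {a ζ : ℂ} (h : HasDerivAt f a ζ) : HasWirt f a 0 ζ := by
  have := (h.hasFDerivAt).restrictScalars ℝ
  refine HasFDerivAt.congr_fderiv this ?_
  ext v
  simp [mul_comm]

lemma hasWirt_const (c ζ : ℂ) : HasWirt (fun _ => c) 0 0 ζ := (hasDerivAt_const ζ c).hasWirt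

lemma HasWirt.conj {f : ℂ → ℂ} {a b ζ : ℂ} (h : HasWirt f a b ζ) :
    HasWirt (fun x => conj (f x)) (conj b) (conj a) ζ := by
  have := (Complex.conjCLE : ℂ →L[ℝ] ℂ).hasFDerivAt.comp ζ h
  refine HasFDerivAt.congr_fderiv this ?_
  ext v
  simp [add_comm]

lemma HasWirt.add {f g : ℂ → ℂ} {a b a' b' ζ : ℂ} (h : HasWirt f a b ζ) (h' : HasWirt g a' b' ζ) :
    HasWirt (fun x => f x + g x) (a + a') (b + b') ζ := by
  have := HasFDerivAt.add h h'
  refine HasFDerivAt.congr_fderiv this ?_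
  ext v
  simp
  ring

lemma HasWirt.mul {f g : ℂ → ℂ} {a b a' b' ζ : ℂ} (h : HasWirt f a b ζ) (h' : HasWirt g a' b' ζ) :
    HasWirt (fun x => f x * g x) (a * g ζ + f ζ * a') (b * g ζ + f ζ * b') ζ := by
  have := HasFDerivAt.mul h h'
  refine HasFDerivAt.congr_fderiv this ?_
  ext v
  simp
  ring

lemma HasDerivAt.comp_hasWirt {f g : ℂ → ℂ} {a b c ζ : ℂ} (hg : HasDerivAt g c (f ζ))
    (h : HasWirt f a b ζ) : HasWirt (fun x => g (f x)) (c * a) (c * b) ζ := by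
  have := (hg.hasFDerivAt.restrictScalars ℝ).comp ζ h
  refine HasFDerivAt.congr_fderiv this ?_
  ext v
  simp
  ring

/-- Quadratic vanishing forces a zero differential. This is what handles the origin and the unit
circle, where the product rule is not available for the amplitude. -/
lemma hasWirt_zero_of_sq_bound {f : ℂ → ℂ} {ζ : ℂ} {C : ℝ} (h0 : f ζ = 0)
    (h : ∀ᶠ x in nhds ζ, ‖f x‖ ≤ C * ‖x - ζ‖ ^ 2) : HasWirt f 0 0 ζ := by
  have hz : wirtCLM 0 0 = 0 := by ext v; simp
  rw [HasWirt, hz, hasFDerivAt_iff_isLittleO]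
  simp only [h0, zero_apply, sub_zero]
  have h1 : f =O[nhds ζ] fun x => ‖x - ζ‖ ^ 2 :=
    Asymptotics.IsBigO.of_bound C (by filter_upwards [h] with x hx; simpa using hx)
  refine h1.trans_isLittleO ?_
  have h2 : (fun x : ℂ => ‖x - ζ‖ ^ 2) =o[nhds ζ] fun x => ‖x - ζ‖ ^ 1 :=
    Asymptotics.IsLittleO.comp_tendsto (f := fun y : ℝ => y ^ 2) (g := fun y : ℝ => y ^ 1)
      (Asymptotics.isLittleO_pow_pow one_lt_two)
      (by
        have : Tendsto (fun x : ℂ => ‖x - ζ‖) (nhds ζ) (nhds ‖ζ - ζ‖) :=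
          (Continuous.tendsto (by fun_prop) ζ)
        simpa using this)
  exact h2.trans_isBigO (Asymptotics.IsBigO.of_bound 1 (by simp))

/-- The integral of `∂F/∂ζ` vanishes for integrable `F` with integrable derivatives. -/
lemma integral_wirt_eq_zero {F a b : ℂ → ℂ} (hF : ∀ ζ, HasWirt F (a ζ) (b ζ) ζ)
    (hi : Integrable F) {g : ℂ → ℝ} (hg : Integrable g) (ha : ∀ ζ, ‖a ζ‖ ≤ g ζ)
    (hb : ∀ ζ, ‖b ζ‖ ≤ g ζ) : Integrable a ∧ ∫ ζ, a ζ = 0 := by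
  have key : ∀ v : ℂ, ‖v‖ = 1 → Integrable (fun ζ => fderiv ℝ F ζ v) ∧
      ∫ ζ, fderiv ℝ F ζ v = 0 := by
    intro v hv
    have h1 : Integrable (fun ζ => fderiv ℝ F ζ v) := by
      refine Integrable.mono' (hg.const_mul 2) (measurable_fderiv_apply_const ℝ F v).aestronglyMeasurable ?_
      refine Eventually.of_forall fun ζ => ?_
      rw [HasFDerivAt.fderiv (hF ζ), wirtCLM_apply]
      refine (norm_add_le _ _).trans ?_
      simp only [norm_mul, RCLike.norm_conj, hv, mul_one]
      linarith [ha ζ, hb ζ]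
    refine ⟨h1, ?_⟩
    -- Integration by parts with the constant function `1` as the other factor; its derivative is
    -- zero.
    have := integral_bilinear_hasLineDerivAt_right_eq_neg_left_of_integrable
      (μ := (volume : Measure ℂ)) (f := fun _ : ℂ => (1 : ℝ)) (f' := fun _ => (0 : ℝ)) (g := F)
      (g' := fun ζ => fderiv ℝ F ζ v) (v := v) (B := ContinuousLinearMap.lsmul ℝ ℝ)
      (by simp) (by simpa using h1) (by simpa using hi)
      (fun x _ => HasFDerivAt.hasLineDerivAt (hasFDerivAt_const (1:ℝ) x) v)
      (fun x _ => HasFDerivAt.hasLineDerivAt ((hF x).differentiableAt.hasFDerivAt) v)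
    simpa using this
  have h1 := key 1 (by simp)
  have h2 := key Complex.I (by simp)
  have e : a = fun ζ => (fderiv ℝ F ζ 1 - Complex.I * fderiv ℝ F ζ Complex.I) / 2 := by
    funext ζ
    exact ((hF ζ).wirtinger_eq).symm
  rw [e]
  refine ⟨(h1.1.sub (h2.1.const_mul _)).div_const _, ?_⟩
  rw [integral_div, integral_sub h1.1 (h2.1.const_mul _), integral_const_mul, h1.2, h2.2]
  simp

/-! ### Infinite-order vanishing on the unit circle. -/

lemma contDiff_wirtinger {f : ℂ → ℂ} (hf : ContDiff ℝ (⊤ : ℕ∞) f) :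
    ContDiff ℝ (⊤ : ℕ∞) (wirtinger f) := by
  have h : ContDiff ℝ (⊤ : ℕ∞) (fderiv ℝ f) := hf.fderiv_right (by simp)
  unfold wirtinger
  exact ((h.clm_apply contDiff_const).sub
    (contDiff_const.mul (h.clm_apply contDiff_const))).div_const _

lemma contDiff_wirtingerBar {f : ℂ → ℂ} (hf : ContDiff ℝ (⊤ : ℕ∞) f) :
    ContDiff ℝ (⊤ : ℕ∞) (wirtingerBar f) := by
  have h : ContDiff ℝ (⊤ : ℕ∞) (fderiv ℝ f) := hf.fderiv_right (by simp)
  unfold wirtingerBar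
  exact ((h.clm_apply contDiff_const).add
    (contDiff_const.mul (h.clm_apply contDiff_const))).div_const _

/-- Symmetry of the second derivative. The data list the `∂/∂ζ̄` derivatives innermost, so
commutation is needed in order to apply one more from the outside. -/
lemma wirtingerBar_wirtinger {f : ℂ → ℂ} (hf : ContDiff ℝ (⊤ : ℕ∞) f) :
    wirtingerBar (wirtinger f) = wirtinger (wirtingerBar f) := by
  have h : ContDiff ℝ (⊤ : ℕ∞) (fderiv ℝ f) := hf.fderiv_right (by simp)
  have hd : Differentiable ℝ (fderiv ℝ f) := h.differentiable (by simp)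
  funext ζ
  have hs : IsSymmSndFDerivAt ℝ f ζ := hf.contDiffAt.isSymmSndFDerivAt (by
    simp only [minSmoothness_of_isRCLikeNormedField]; exact WithTop.coe_le_coe.2 le_top)
  have e1 : ∀ v c : ℂ, HasFDerivAt (fun x => (fderiv ℝ f x 1 + c * fderiv ℝ f x Complex.I) / 2)
      (((2 : ℂ)⁻¹) • ((ContinuousLinearMap.apply ℝ ℂ (1 : ℂ)).comp (fderiv ℝ (fderiv ℝ f) ζ) +
        c • (ContinuousLinearMap.apply ℝ ℂ Complex.I).comp (fderiv ℝ (fderiv ℝ f) ζ))) ζ := by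
    intro v c
    have a1 := (ContinuousLinearMap.apply ℝ ℂ (1 : ℂ)).hasFDerivAt.comp ζ (hd ζ).hasFDerivAt
    have a2 := (ContinuousLinearMap.apply ℝ ℂ Complex.I).hasFDerivAt.comp ζ (hd ζ).hasFDerivAt
    have := (a1.add (a2.const_mul c)).const_mul (2 : ℂ)⁻¹
    refine this.congr_of_eventuallyEq (Eventually.of_forall fun x => ?_)
    simp
    ring
  have e2 := (e1 0 Complex.I).fderiv
  have e3 := (e1 0 (-Complex.I)).fderiv
  have f1 : wirtingerBar f = fun x => (fderiv ℝ f x 1 + Complex.I * fderiv ℝ f x Complex.I) / 2 :=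
    rfl
  have f2 : wirtinger f = fun x => (fderiv ℝ f x 1 + (-Complex.I) * fderiv ℝ f x Complex.I) / 2 := by
    funext x; rw [wirtinger]; ring
  rw [wirtingerBar, wirtinger, f2, f1, e2, e3]
  have := hs 1 Complex.I
  simp [this]
  ring

lemma contDiff_iterate_wirtinger {f : ℂ → ℂ} (hf : ContDiff ℝ (⊤ : ℕ∞) f) (m n : ℕ) :
    ContDiff ℝ (⊤ : ℕ∞) (wirtinger^[m] (wirtingerBar^[n] f)) := by
  have h1 : ContDiff ℝ (⊤ : ℕ∞) (wirtingerBar^[n] f) := by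
    induction n with
    | zero => simpa using hf
    | succ k ih => rw [Function.iterate_succ_apply']; exact contDiff_wirtingerBar ih
  induction m with
  | zero => simpa using h1
  | succ k ih => rw [Function.iterate_succ_apply']; exact contDiff_wirtinger ih

lemma wirtingerBar_iterate_wirtinger {f : ℂ → ℂ} (hf : ContDiff ℝ (⊤ : ℕ∞) f) (m n : ℕ) :
    wirtingerBar (wirtinger^[m] (wirtingerBar^[n] f)) =
      wirtinger^[m] (wirtingerBar^[n + 1] f) := by
  induction m with
  | zero => simp [Function.iterate_succ_apply']
  | succ k ih =>
    rw [Function.iterate_succ_apply', Function.iterate_succ_apply',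
      wirtingerBar_wirtinger (contDiff_iterate_wirtinger hf k n), ih]

lemma norm_fderiv_le_wirtinger {f : ℂ → ℂ} {ζ : ℂ} (h : DifferentiableAt ℝ f ζ) :
    ‖fderiv ℝ f ζ‖ ≤ ‖wirtinger f ζ‖ + ‖wirtingerBar f ζ‖ := by
  rw [HasFDerivAt.fderiv h.hasWirt]
  exact norm_wirtCLM_le _ _

/-- A smooth function all of whose Wirtinger derivatives vanish on the unit circle vanishes there to
infinite order, together with these derivatives. -/
lemma exists_bound_near_circle {f : ℂ → ℂ} (hf : ContDiff ℝ (⊤ : ℕ∞) f)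
    (h0 : ∀ (m n : ℕ) (ζ : ℂ), ‖ζ‖ = 1 → (wirtinger^[m] (wirtingerBar^[n] f)) ζ = 0)
    (N m n : ℕ) : ∃ C : ℝ, 0 ≤ C ∧ ∀ ζ : ℂ, 1 / 2 ≤ ‖ζ‖ → ‖ζ‖ ≤ 2 →
      ‖(wirtinger^[m] (wirtingerBar^[n] f)) ζ‖ ≤ C * |‖ζ‖ - 1| ^ N := by
  induction N generalizing m n with
  | zero =>
    obtain ⟨C, hC⟩ := (isCompact_closedBall (0 : ℂ) 2).exists_bound_of_continuousOn
      (contDiff_iterate_wirtinger hf m n).continuous.continuousOn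
    refine ⟨|C|, abs_nonneg _, fun ζ _ h2 => ?_⟩
    have := hC ζ (by simpa using h2)
    simpa using this.trans (le_abs_self C)
  | succ N ih =>
    -- Both first derivatives of the current function vanish to order `N`. The mean value inequality
    -- on the radial segment from `ζ / |ζ|`, where the function is zero, gains one order. Hence the
    -- induction runs over all `m`, `n` at once.
    obtain ⟨C1, hC1, h1⟩ := ih (m + 1) n
    obtain ⟨C2, hC2, h2⟩ := ih m (n + 1)
    refine ⟨C1 + C2, by positivity, fun ζ ha hb => ?_⟩
    set g := wirtinger^[m] (wirtingerBar^[n] f) with hg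
    have hgd : Differentiable ℝ g := (contDiff_iterate_wirtinger hf m n).differentiable (by simp)
    have hpos : 0 < ‖ζ‖ := by linarith
    set ω : ℂ := (‖ζ‖ : ℂ)⁻¹ * ζ with hω
    have hωn : ‖ω‖ = 1 := by
      rw [hω, norm_mul, norm_inv, Complex.norm_real, norm_norm, inv_mul_cancel₀ hpos.ne']
    have hζω : ζ = (‖ζ‖ : ℂ) * ω := by
      have : (‖ζ‖ : ℂ) ≠ 0 := by exact_mod_cast hpos.ne'
      rw [hω]; field_simp
    have hseg : ∀ x ∈ segment ℝ ω ζ, 1 / 2 ≤ ‖x‖ ∧ ‖x‖ ≤ 2 ∧ |‖x‖ - 1| ≤ |‖ζ‖ - 1| := by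
      rintro x ⟨s, t, hs, ht, hst, rfl⟩
      have e : s • ω + t • ζ = ((s + t * ‖ζ‖ : ℝ) : ℂ) * ω := by
        conv_lhs => rw [hζω]
        simp only [Complex.real_smul]
        push_cast; ring
      have hnn : 0 ≤ s + t * ‖ζ‖ := by positivity
      rw [e, norm_mul, hωn, mul_one, Complex.norm_real, Real.norm_of_nonneg hnn]
      have hs' : s = 1 - t := by linarith
      subst hs'
      refine ⟨by nlinarith, by nlinarith, ?_⟩
      have : 1 - t + t * ‖ζ‖ - 1 = t * (‖ζ‖ - 1) := by ring
      rw [this, abs_mul, abs_of_nonneg ht]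
      exact mul_le_of_le_one_left (abs_nonneg _) (by linarith)
    have hmv := (convex_segment (𝕜 := ℝ) ω ζ).norm_image_sub_le_of_norm_fderiv_le (f := g)
      (C := (C1 + C2) * |‖ζ‖ - 1| ^ N) (fun x _ => hgd x) (fun x hx => by
        obtain ⟨xa, xb, xc⟩ := hseg x hx
        refine (norm_fderiv_le_wirtinger (hgd x)).trans ?_
        have k1 := h1 x xa xb
        have k2 := h2 x xa xb
        rw [Function.iterate_succ_apply'] at k1
        rw [← wirtingerBar_iterate_wirtinger hf] at k2
        have hp : |‖x‖ - 1| ^ N ≤ |‖ζ‖ - 1| ^ N := by gcongr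
        nlinarith [mul_le_mul_of_nonneg_left hp hC1, mul_le_mul_of_nonneg_left hp hC2])
      (left_mem_segment ℝ ω ζ) (right_mem_segment ℝ ω ζ)
    have hd : ‖ζ - ω‖ = |‖ζ‖ - 1| := by
      have : ζ - ω = ((‖ζ‖ - 1 : ℝ) : ℂ) * ω := by
        conv_lhs => rw [hζω]
        push_cast; ring
      rw [this, norm_mul, hωn, mul_one, Complex.norm_real, Real.norm_eq_abs]
    have hgω : g ω = 0 := h0 m n ω hωn
    rw [hgω, sub_zero, hd] at hmv
    rw [pow_succ]
    linarith

/-! ### Decay of the scattering data against the singular weight. -/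

/-- The weight measuring the distance to `0`, to `∞` and to the unit circle. -/
noncomputable def circWeight (ζ : ℂ) : ℝ := 1 + ‖ζ‖ + ‖ζ‖⁻¹ + |‖ζ‖ ^ 2 - 1|⁻¹

lemma one_add_norm_le_circWeight (ζ : ℂ) : 1 + ‖ζ‖ ≤ circWeight ζ := by
  have : 0 ≤ ‖ζ‖⁻¹ := by positivity
  have : 0 ≤ |‖ζ‖ ^ 2 - 1|⁻¹ := by positivity
  unfold circWeight; linarith

lemma one_le_circWeight (ζ : ℂ) : 1 ≤ circWeight ζ := by
  have := one_add_norm_le_circWeight ζ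
  linarith [norm_nonneg ζ]

lemma norm_le_circWeight (ζ : ℂ) : ‖ζ‖ ≤ circWeight ζ := by
  have := one_add_norm_le_circWeight ζ
  linarith

lemma inv_norm_le_circWeight (ζ : ℂ) : ‖ζ‖⁻¹ ≤ circWeight ζ := by
  have : 0 ≤ |‖ζ‖ ^ 2 - 1|⁻¹ := by positivity
  unfold circWeight; linarith [norm_nonneg ζ]

lemma inv_abs_le_circWeight (ζ : ℂ) : |‖ζ‖ ^ 2 - 1|⁻¹ ≤ circWeight ζ := by
  have : 0 ≤ ‖ζ‖⁻¹ := by positivity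
  unfold circWeight; linarith [norm_nonneg ζ]

lemma circWeight_le_of_two_le {ζ : ℂ} (h : 2 ≤ ‖ζ‖) : circWeight ζ ≤ 3 * ‖ζ‖ := by
  have h1 : ‖ζ‖⁻¹ ≤ 1 := inv_le_one_of_one_le₀ (by linarith)
  have h2 : |‖ζ‖ ^ 2 - 1|⁻¹ ≤ 1 := by
    apply inv_le_one_of_one_le₀
    rw [abs_of_nonneg] <;> nlinarith
  unfold circWeight; linarith

lemma circWeight_le_of_le_half {ζ : ℂ} (h0 : ζ ≠ 0) (h : ‖ζ‖ ≤ 1 / 2) :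
    circWeight ζ ≤ 3 * ‖ζ‖⁻¹ := by
  have hp : 0 < ‖ζ‖ := norm_pos_iff.2 h0
  have h1 : 2 ≤ ‖ζ‖⁻¹ := by
    rw [le_inv_comm₀ (by norm_num) hp]; linarith
  have h2 : |‖ζ‖ ^ 2 - 1|⁻¹ ≤ 2 := by
    rw [inv_le_comm₀ _ (by norm_num), abs_of_nonpos] <;> try nlinarith
    rw [abs_pos]; nlinarith
  unfold circWeight; linarith

lemma circWeight_le_of_mid {ζ : ℂ} (h1 : 1 / 2 ≤ ‖ζ‖) (h2 : ‖ζ‖ ≤ 2) (h3 : ‖ζ‖ ≠ 1) :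
    circWeight ζ ≤ 16 * |‖ζ‖ - 1|⁻¹ := by
  have hp : 0 < |‖ζ‖ - 1| := abs_pos.2 (sub_ne_zero.2 h3)
  have a1 : ‖ζ‖⁻¹ ≤ 2 := by
    rw [inv_le_comm₀ (by linarith) (by norm_num)]; linarith
  have a2 : |‖ζ‖ ^ 2 - 1|⁻¹ ≤ |‖ζ‖ - 1|⁻¹ := by
    apply inv_anti₀ hp
    have : ‖ζ‖ ^ 2 - 1 = (‖ζ‖ - 1) * (‖ζ‖ + 1) := by ring
    rw [this, abs_mul]
    apply le_mul_of_one_le_right hp.le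
    rw [abs_of_nonneg] <;> linarith
  have a3 : 1 ≤ |‖ζ‖ - 1|⁻¹ := by
    apply one_le_inv_iff₀.2 ⟨hp, ?_⟩
    rw [abs_le]; constructor <;> linarith
  unfold circWeight; linarith

/-- Three regions: Schwartz decay for large `ζ`, the symmetry `b(1/ζ̄) = b(ζ)` transporting that
decay to small `ζ`, and infinite-order vanishing in the annulus between. In each region `circWeight`
is at most `16` times the relevant one of `|ζ|`, `|ζ|⁻¹`, `||ζ| - 1|⁻¹`. -/
lemma SchwartzMap.exists_circWeight_bound {b : SchwartzMap ℂ ℂ}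
    (hb : IsTransparentScatteringData b) (N : ℕ) :
    ∃ C : ℝ, 0 ≤ C ∧ ∀ ζ : ℂ, ζ ≠ 0 → ‖ζ‖ ≠ 1 →
      ‖b ζ‖ * circWeight ζ ^ N ≤ C ∧ ‖fderiv ℝ b ζ‖ * circWeight ζ ^ N ≤ C := by
  have hsm : ContDiff ℝ (⊤ : ℕ∞) (fun w => b w) := b.smooth ⊤
  have hdiff : Differentiable ℝ (fun w => b w) := hsm.differentiable (by simp)
  obtain ⟨A0, -, hA0⟩ := exists_bound_near_circle hsm hb.deriv_eq_zero N 0 0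
  obtain ⟨A1, -, hA1⟩ := exists_bound_near_circle hsm hb.deriv_eq_zero N 1 0
  obtain ⟨A2, -, hA2⟩ := exists_bound_near_circle hsm hb.deriv_eq_zero N 0 1
  obtain ⟨D0, -, hD0⟩ := b.decay N 0
  obtain ⟨D1, -, hD1⟩ := b.decay N 1
  -- Two extra orders of decay pay for the differential of `ζ ↦ 1 / ζ̄`, of size `|ζ|⁻²`.
  obtain ⟨D2, -, hD2⟩ := b.decay (N + 2) 1
  simp only [norm_iteratedFDeriv_zero] at hD0
  simp only [norm_iteratedFDeriv_one] at hD1 hD2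
  refine ⟨16 ^ N * (|A0| + |A1| + |A2| + |D0| + |D1| + |D2|), by positivity, fun ζ h0 h1 => ?_⟩
  have hL : 0 ≤ circWeight ζ := zero_le_one.trans (one_le_circWeight ζ)
  have hsum : ∀ X R K : ℝ, 0 ≤ X → 0 ≤ R → circWeight ζ ≤ 16 * R → X * R ^ N ≤ K →
      K ≤ |A0| + |A1| + |A2| + |D0| + |D1| + |D2| →
      X * circWeight ζ ^ N ≤ 16 ^ N * (|A0| + |A1| + |A2| + |D0| + |D1| + |D2|) := by
    intro X R K hX hR hRL hK hK'
    calc X * circWeight ζ ^ N ≤ X * (16 * R) ^ N := by gcongr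
      _ = 16 ^ N * (X * R ^ N) := by rw [mul_pow]; ring
      _ ≤ _ := by gcongr; exact hK.trans hK'
  have p0 := abs_nonneg A0
  have p1 := abs_nonneg A1
  have p2 := abs_nonneg A2
  have p3 := abs_nonneg D0
  have p4 := abs_nonneg D1
  have p5 := abs_nonneg D2
  have q0 := le_abs_self A0
  have q1 := le_abs_self A1
  have q2 := le_abs_self A2
  have q3 := le_abs_self D0
  have q4 := le_abs_self D1
  have q5 := le_abs_self D2
  have hn := norm_nonneg ζ
  rcases le_total 2 ‖ζ‖ with hbig | hbig
  · have hw := circWeight_le_of_two_le hbig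
    refine ⟨hsum _ ‖ζ‖ D0 (norm_nonneg _) hn (by linarith) ?_ (by linarith),
      hsum _ ‖ζ‖ D1 (norm_nonneg _) hn (by linarith) ?_ (by linarith)⟩
    · rw [mul_comm]; exact hD0 ζ
    · rw [mul_comm]; exact hD1 ζ
  rcases le_total ‖ζ‖ (1 / 2) with hsmall | hsmall
  · have hw := circWeight_le_of_le_half h0 hsmall
    have hi : 0 ≤ ‖ζ‖⁻¹ := by positivity
    have hσ : ‖1 / conj ζ‖ = ‖ζ‖⁻¹ := by simp
    refine ⟨hsum _ ‖ζ‖⁻¹ D0 (norm_nonneg _) hi (by linarith) ?_ (by linarith),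
      hsum _ ‖ζ‖⁻¹ D2 (norm_nonneg _) hi (by linarith) ?_ (by linarith)⟩
    · rw [← hb.symm_inv ζ h0, mul_comm, ← hσ]; exact hD0 _
    · have hc : HasWirt (fun x => 1 / conj x) 0 (conj (-(ζ ^ 2)⁻¹)) ζ := by
        have := ((hasDerivAt_inv h0).hasWirt).conj
        refine (this.congr_coeff (by simp) rfl).congr_of_eventuallyEq
          (Eventually.of_forall fun x => by simp)
      have hcomp : HasFDerivAt (fun x => b (1 / conj x))
          ((fderiv ℝ b (1 / conj ζ)).comp (wirtCLM 0 (conj (-(ζ ^ 2)⁻¹)))) ζ :=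
        ((hdiff (1 / conj ζ)).hasFDerivAt).comp ζ hc
      have heq : (fun x => b x) =ᶠ[nhds ζ] fun x => b (1 / conj x) := by
        filter_upwards [isOpen_ne.mem_nhds h0] with x hx
        exact (hb.symm_inv x hx).symm
      have e : fderiv ℝ b ζ = _ := (hcomp.congr_of_eventuallyEq heq).fderiv
      rw [e]
      have hle : ‖wirtCLM 0 (conj (-(ζ ^ 2)⁻¹))‖ ≤ ‖ζ‖⁻¹ ^ 2 := by
        refine (norm_wirtCLM_le _ _).trans ?_
        simp
      calc _ ≤ (‖fderiv ℝ b (1 / conj ζ)‖ * ‖ζ‖⁻¹ ^ 2) * ‖ζ‖⁻¹ ^ N := by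
            gcongr
            exact (ContinuousLinearMap.opNorm_comp_le _ _).trans (by gcongr)
        _ = ‖1 / conj ζ‖ ^ (N + 2) * ‖fderiv ℝ b (1 / conj ζ)‖ := by rw [hσ]; ring
        _ ≤ D2 := hD2 _
  · have hw := circWeight_le_of_mid hsmall hbig h1
    have hp : 0 < |‖ζ‖ - 1| := abs_pos.2 (sub_ne_zero.2 h1)
    have hconv : ∀ X A : ℝ, X ≤ A * |‖ζ‖ - 1| ^ N → X * |‖ζ‖ - 1|⁻¹ ^ N ≤ A := by
      intro X A h
      rw [inv_pow, ← div_eq_mul_inv, div_le_iff₀ (by positivity)]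
      exact h
    refine ⟨hsum _ |‖ζ‖ - 1|⁻¹ A0 (norm_nonneg _) (by positivity) hw (hconv _ _ ?_) (by linarith),
      hsum _ |‖ζ‖ - 1|⁻¹ (A1 + A2) (norm_nonneg _) (by positivity) hw (hconv _ _ ?_) (by linarith)⟩
    · simpa using hA0 ζ hsmall hbig
    · have k1 := hA1 ζ hsmall hbig
      have k2 := hA2 ζ hsmall hbig
      simp only [Function.iterate_succ, Function.iterate_zero, Function.comp_apply, id] at k1 k2
      have := norm_fderiv_le_wirtinger (hdiff ζ)
      rw [add_mul]
      exact this.trans (add_le_add k1 k2)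

/-! ### Weighted planar integrals with a singularity at an arbitrary point. -/

/-- The decaying weight `(1 + |ζ|)⁻³` on the plane. -/
noncomputable def planeWeight (ζ : ℂ) : ℝ := ((1 + ‖ζ‖) ^ 3)⁻¹

lemma planeWeight_pos (ζ : ℂ) : 0 < planeWeight ζ := by unfold planeWeight; positivity

lemma planeWeight_le_one (ζ : ℂ) : planeWeight ζ ≤ 1 := by
  unfold planeWeight
  apply inv_le_one_of_one_le₀
  exact one_le_pow₀ (by linarith [norm_nonneg ζ])

lemma measurable_planeWeight : Measurable planeWeight := by
  unfold planeWeight; fun_prop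

lemma integrable_planeWeight : Integrable planeWeight := by
  have := integrable_one_add_norm (E := ℂ) (μ := volume) (r := 3)
    (by rw [Complex.finrank_real_complex]; norm_num)
  refine this.congr (Eventually.of_forall fun x => ?_)
  have h : 0 ≤ 1 + ‖x‖ := by positivity
  simp only [planeWeight]
  rw [Real.rpow_neg h]
  norm_cast

/-- In polar coordinates the Jacobian `y` cancels one factor of the kernel and leaves `∫₀¹ dy / (y +
κ)`. The endpoint `1` is removed from the interval only to match the strict inequality in the
indicator. -/
lemma integral_indicator_inv_mul_add {κ : ℝ} (hκ : 0 < κ) :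
    Integrable (fun x : ℂ => (Set.Iio (1 : ℝ)).indicator (fun y => (y * (y + κ))⁻¹) ‖x‖) ∧
    ∫ x : ℂ, (Set.Iio (1 : ℝ)).indicator (fun y => (y * (y + κ))⁻¹) ‖x‖ =
      2 * volume.real (Metric.ball (0 : ℂ) 1) * Real.log (1 + κ⁻¹) := by
  have hco : Set.EqOn (fun y : ℝ => y ^ (Module.finrank ℝ ℂ - 1) •
      (Set.Iio (1 : ℝ)).indicator (fun y => (y * (y + κ))⁻¹) y)
      ((Set.Ioc (0 : ℝ) 1 \ {1}).indicator fun y => (y + κ)⁻¹) (Set.Ioi 0) := by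
    intro y hy
    have hy : 0 < y := hy
    simp only [Complex.finrank_real_complex, Nat.add_one_sub_one, pow_one, smul_eq_mul,
      Set.indicator, Set.mem_Iio, Set.mem_sdiff, Set.mem_Ioc, Set.mem_singleton_iff]
    by_cases h : y < 1
    · rw [if_pos h, if_pos ⟨⟨hy, h.le⟩, h.ne⟩]
      field_simp
    · rw [if_neg h, if_neg, mul_zero]
      rintro ⟨⟨-, h1⟩, h2⟩
      exact h (lt_of_le_of_ne h1 h2)
  have hms : MeasurableSet (Set.Ioc (0 : ℝ) 1 \ {1}) := by measurability
  have hsub : Set.Ioc (0 : ℝ) 1 \ {1} ⊆ Set.Ioi 0 := fun y hy => hy.1.1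
  have hae : (Set.Ioc (0 : ℝ) 1 \ {1} : Set ℝ) =ᵐ[volume] Set.Ioc (0 : ℝ) 1 :=
    sdiff_null_ae_eq_self (by simp)
  have hcont : ContinuousOn (fun y : ℝ => (y + κ)⁻¹) (Set.uIcc 0 1) := by
    refine ContinuousOn.inv₀ (by fun_prop) fun y hy => ?_
    rw [Set.uIcc_of_le zero_le_one] at hy
    linarith [hy.1]
  have hint : IntegrableOn (fun y : ℝ => (y + κ)⁻¹) (Set.Ioc 0 1) :=
    (intervalIntegrable_iff_integrableOn_Ioc_of_le zero_le_one).1 hcont.intervalIntegrable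
  have hint' : IntegrableOn (fun y : ℝ => (y + κ)⁻¹) (Set.Ioc 0 1 \ {1}) :=
    hint.mono_set Set.sdiff_subset
  constructor
  · refine (integrable_fun_norm_addHaar (volume : Measure ℂ)
      (f := (Set.Iio (1 : ℝ)).indicator (fun y => (y * (y + κ))⁻¹))).2 ?_
    rw [integrableOn_congr_fun hco measurableSet_Ioi]
    exact ((integrable_indicator_iff hms).2 hint').integrableOn
  · rw [integral_fun_norm_addHaar (volume : Measure ℂ)
      ((Set.Iio (1 : ℝ)).indicator (fun y => (y * (y + κ))⁻¹)),
      setIntegral_congr_fun measurableSet_Ioi hco, setIntegral_indicator hms,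
      Set.inter_eq_self_of_subset_right hsub, setIntegral_congr_set hae,
      ← intervalIntegral.integral_of_le zero_le_one,
      intervalIntegral.integral_comp_add_right (fun y => y⁻¹) κ,
      integral_inv_of_pos (by linarith) (by linarith), Complex.finrank_real_complex]
    have : (1 + κ) / (0 + κ) = 1 + κ⁻¹ := by field_simp; ring
    rw [this]
    simp only [nsmul_eq_mul, smul_eq_mul]
    push_cast; ring

/-- A weighted integral with a logarithmic bound, uniform in the position of the singularity. -/
lemma exists_integral_planeWeight_bound : ∃ C : ℝ, 0 ≤ C ∧ ∀ (p : ℂ) (κ : ℝ), 0 < κ →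
    Integrable (fun ζ => planeWeight ζ * (‖ζ - p‖ * (‖ζ - p‖ + κ))⁻¹) ∧
    ∫ ζ, planeWeight ζ * (‖ζ - p‖ * (‖ζ - p‖ + κ))⁻¹ ≤ C * (1 + Real.log (1 + κ⁻¹)) := by
  refine ⟨2 * volume.real (Metric.ball (0 : ℂ) 1) + ∫ ζ, planeWeight ζ,
    add_nonneg (by positivity) (integral_nonneg fun ζ => (planeWeight_pos ζ).le),
    fun p κ hκ => ?_⟩
  obtain ⟨h1, h2⟩ := integral_indicator_inv_mul_add hκ
  have h1' := h1.comp_sub_right p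
  -- Within distance `1` of `p` the weight is dropped; farther away the kernel is at most `1`.
  have hle : ∀ ζ, planeWeight ζ * (‖ζ - p‖ * (‖ζ - p‖ + κ))⁻¹ ≤
      (Set.Iio (1 : ℝ)).indicator (fun y => (y * (y + κ))⁻¹) ‖ζ - p‖ + planeWeight ζ := by
    intro ζ
    have hv := norm_nonneg (ζ - p)
    have hw := planeWeight_pos ζ
    by_cases h : ‖ζ - p‖ < 1
    · rw [Set.indicator_of_mem (by exact h)]
      have := mul_le_of_le_one_left (a := planeWeight ζ) (b := (‖ζ - p‖ * (‖ζ - p‖ + κ))⁻¹)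
        (by positivity) (planeWeight_le_one ζ)
      linarith
    · rw [Set.indicator_of_notMem (by exact h), zero_add]
      apply mul_le_of_le_one_right hw.le
      apply inv_le_one_of_one_le₀
      push Not at h
      nlinarith
  have hi : Integrable (fun ζ => planeWeight ζ * (‖ζ - p‖ * (‖ζ - p‖ + κ))⁻¹) := by
    refine Integrable.mono' (h1'.add integrable_planeWeight)
      (Measurable.aestronglyMeasurable (measurable_planeWeight.mul (by fun_prop)))
      (Eventually.of_forall fun ζ => ?_)
    rw [Real.norm_of_nonneg (mul_nonneg (planeWeight_pos ζ).le (by positivity))]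
    exact hle ζ
  refine ⟨hi, (integral_mono hi (h1'.add integrable_planeWeight) hle).trans ?_⟩
  simp only [Pi.add_apply]
  rw [integral_add h1' integrable_planeWeight, integral_sub_right_eq_self
    (fun x : ℂ => (Set.Iio (1 : ℝ)).indicator (fun y => (y * (y + κ))⁻¹) ‖x‖), h2]
  have hlog : 0 ≤ Real.log (1 + κ⁻¹) := Real.log_nonneg (by linarith [inv_pos.2 hκ])
  have hb : 0 ≤ volume.real (Metric.ball (0 : ℂ) 1) := by positivity
  have hI : 0 ≤ ∫ ζ, planeWeight ζ := integral_nonneg fun ζ => (planeWeight_pos ζ).le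
  nlinarith [mul_nonneg hI hlog]

lemma exists_integral_planeWeight_div_bound : ∃ C : ℝ, 0 ≤ C ∧ ∀ p : ℂ,
    Integrable (fun ζ => planeWeight ζ * ‖ζ - p‖⁻¹) ∧
    ∫ ζ, planeWeight ζ * ‖ζ - p‖⁻¹ ≤ C := by
  obtain ⟨C, hC0, hC⟩ := exists_integral_planeWeight_bound
  refine ⟨2 * (C * (1 + Real.log (1 + 1⁻¹))) + ∫ ζ, planeWeight ζ,
    add_nonneg (mul_nonneg zero_le_two (mul_nonneg hC0 (add_nonneg zero_le_one
      (Real.log_nonneg (by norm_num))))) (integral_nonneg fun ζ => (planeWeight_pos ζ).le),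
    fun p => ?_⟩
  obtain ⟨h1, h2⟩ := hC p 1 one_pos
  have hle : ∀ ζ, planeWeight ζ * ‖ζ - p‖⁻¹ ≤
      2 * (planeWeight ζ * (‖ζ - p‖ * (‖ζ - p‖ + 1))⁻¹) + planeWeight ζ := by
    intro ζ
    have hw := planeWeight_pos ζ
    have : ‖ζ - p‖⁻¹ ≤ 2 * (‖ζ - p‖ * (‖ζ - p‖ + 1))⁻¹ + 1 := by
      rcases (norm_nonneg (ζ - p)).eq_or_lt with h | h
      · rw [← h]; simp
      · rcases le_total 1 ‖ζ - p‖ with h3 | h3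
        · have h4 : ‖ζ - p‖⁻¹ ≤ 1 := inv_le_one_of_one_le₀ h3
          have : 0 ≤ (‖ζ - p‖ * (‖ζ - p‖ + 1))⁻¹ := by positivity
          linarith
        · have : ‖ζ - p‖⁻¹ ≤ 2 * (‖ζ - p‖ * (‖ζ - p‖ + 1))⁻¹ := by
            rw [inv_eq_one_div, ← div_eq_mul_inv, div_le_div_iff₀ h (by positivity)]
            nlinarith
          linarith
    nlinarith
  have hi : Integrable (fun ζ => planeWeight ζ * ‖ζ - p‖⁻¹) := by
    refine Integrable.mono' ((h1.const_mul 2).add integrable_planeWeight)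
      (Measurable.aestronglyMeasurable (measurable_planeWeight.mul (by fun_prop)))
      (Eventually.of_forall fun ζ => ?_)
    rw [Real.norm_of_nonneg (mul_nonneg (planeWeight_pos ζ).le (by positivity))]
    exact hle ζ
  refine ⟨hi, (integral_mono hi ((h1.const_mul 2).add integrable_planeWeight) hle).trans ?_⟩
  simp only [Pi.add_apply]
  rw [integral_add (h1.const_mul 2) integrable_planeWeight, integral_const_mul]
  linarith

/-- The kernel is the dilation by `κ` of a fixed integrable function, normalised so that its mass
does not depend on `κ`. -/
lemma exists_integral_poisson_bound : ∃ C : ℝ, 0 ≤ C ∧ ∀ (p : ℂ) (κ : ℝ), 0 < κ →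
    Integrable (fun ζ : ℂ => κ ^ 2 / (‖ζ - p‖ ^ 2 + κ ^ 2) ^ 2) ∧
    ∫ ζ : ℂ, κ ^ 2 / (‖ζ - p‖ ^ 2 + κ ^ 2) ^ 2 ≤ C := by
  set f : ℂ → ℝ := fun x => ((‖x‖ ^ 2 + 1) ^ 2)⁻¹ with hf
  have hfi : Integrable f := by
    refine Integrable.mono' (integrable_planeWeight.const_mul 4)
      (Measurable.aestronglyMeasurable (by fun_prop)) (Eventually.of_forall fun x => ?_)
    rw [Real.norm_of_nonneg (by positivity), hf]
    simp only [planeWeight]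
    rw [← div_eq_mul_inv, inv_eq_one_div, div_le_div_iff₀ (by positivity) (by positivity)]
    have hx := norm_nonneg x
    have h1 : (1 + ‖x‖) ^ 2 ≤ 2 * (‖x‖ ^ 2 + 1) := by nlinarith [sq_nonneg (‖x‖ - 1)]
    have h2 : (1 + ‖x‖) ^ 3 ≤ (1 + ‖x‖) ^ 4 := pow_le_pow_right₀ (by linarith) (by norm_num)
    have h3 : ((1 + ‖x‖) ^ 2) ^ 2 ≤ (2 * (‖x‖ ^ 2 + 1)) ^ 2 := by gcongr
    nlinarith
  refine ⟨∫ x, f x, integral_nonneg fun x => by simp only [hf]; positivity, fun p κ hκ => ?_⟩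
  have e : ∀ x : ℂ, κ ^ 2 / (‖x‖ ^ 2 + κ ^ 2) ^ 2 = (κ ^ 2)⁻¹ * f (κ⁻¹ • x) := by
    intro x
    simp only [hf, norm_smul, norm_inv, Real.norm_of_nonneg hκ.le]
    have : (0:ℝ) < ‖x‖ ^ 2 + κ ^ 2 := by positivity
    have : (0:ℝ) < ‖x‖ ^ 2 + 1 * κ ^ 2 := by positivity
    field_simp
  have hi : Integrable (fun x : ℂ => κ ^ 2 / (‖x‖ ^ 2 + κ ^ 2) ^ 2) := by
    simp_rw [e]
    exact (hfi.comp_smul (inv_ne_zero hκ.ne')).const_mul _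
  refine ⟨hi.comp_sub_right p, ?_⟩
  rw [integral_sub_right_eq_self (fun x : ℂ => κ ^ 2 / (‖x‖ ^ 2 + κ ^ 2) ^ 2)]
  simp_rw [e]
  rw [integral_const_mul, Measure.integral_comp_smul, Complex.finrank_real_complex]
  rw [inv_pow, inv_inv, abs_of_nonneg (by positivity), smul_eq_mul, ← mul_assoc,
    inv_mul_cancel₀ (by positivity), one_mul]

/-! ### The phase and its stationary points. -/

/-- The derivative `∂S/∂ζ` of the phase. -/
noncomputable def phaseD (u ζ : ℂ) : ℂ :=
  -(1 / 2) * (conj u - u / ζ ^ 2) + 3 * ζ ^ 2 - 3 / ζ ^ 4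

/-- The derivative `∂²S/∂ζ²` of the phase. -/
noncomputable def phaseD2 (u ζ : ℂ) : ℂ := -u / ζ ^ 3 + 6 * ζ + 12 / ζ ^ 5

/-- The phase is twice the real part of this function. -/
noncomputable def phaseH (u ζ : ℂ) : ℂ :=
  -(1 / 2) * (ζ * conj u + u / ζ) + ζ ^ 3 + 1 / ζ ^ 3

lemma phaseS_eq (u ζ : ℂ) : phaseS u ζ = phaseH u ζ + conj (phaseH u ζ) := by
  simp only [phaseS, phaseH, map_add, map_mul, map_neg, map_div₀, map_one, map_pow,
    Complex.conj_conj, map_ofNat]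
  ring

lemma hasDerivAt_phaseH (u : ℂ) {ζ : ℂ} (h : ζ ≠ 0) :
    HasDerivAt (phaseH u) (phaseD u ζ) ζ := by
  have h1 := (hasDerivAt_inv h)
  have h3 := (h1.pow 3)
  have := (((((hasDerivAt_id ζ).mul_const (conj u)).add (h1.const_mul u)).const_mul
    (-(1 / 2) : ℂ)).add (hasDerivAt_pow 3 ζ)).add h3
  refine (this.congr_deriv ?_).congr_of_eventuallyEq (Eventually.of_forall fun x => ?_)
  · simp only [phaseD]; push_cast; field_simp; simp; ring
  · simp [phaseH, div_eq_mul_inv]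

lemma hasDerivAt_phaseD (u : ℂ) {ζ : ℂ} (h : ζ ≠ 0) :
    HasDerivAt (phaseD u) (phaseD2 u ζ) ζ := by
  have h1 := (hasDerivAt_inv h)
  have h2 := (h1.pow 2)
  have h4 := (h1.pow 4)
  have := ((((hasDerivAt_const ζ (conj u)).sub (h2.const_mul u)).const_mul
    (-(1 / 2) : ℂ)).add ((hasDerivAt_pow 2 ζ).const_mul 3)).sub (h4.const_mul 3)
  refine (this.congr_deriv ?_).congr_of_eventuallyEq (Eventually.of_forall fun x => ?_)
  · simp only [phaseD2]; push_cast; field_simp; simp; ring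
  · simp [phaseD, div_eq_mul_inv]

/-- The relations between coefficients and roots, together with their conjugates, show that `1 / ā`
is again a root of the cubic. Since `|a| < 1` it differs from `a`, so it is `b` or `c`; as the
product of the roots is `1`, the third root is unimodular. -/
lemma reflected_root {u a b c : ℂ} (ha : ‖a‖ < 1) (hs : conj u = 6 * (a + b + c))
    (hp : u = 6 * (a * b + a * c + b * c)) (h1 : a * b * c = 1) :
    (1 ≤ ‖b‖ ∧ ‖c‖ = 1) ∨ (1 ≤ ‖c‖ ∧ ‖b‖ = 1) := by
  have ha0 : a ≠ 0 := by rintro rfl; simp at h1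
  have hna : 0 < ‖a‖ := norm_pos_iff.2 ha0
  have hroot : (1 - a * conj a) * ((1 - conj a * b) * (1 - conj a * c)) = 0 := by
    have e1 : conj (conj u) = conj (6 * (a + b + c)) := by rw [hs]
    have e2 : conj u = conj (6 * (a * b + a * c + b * c)) := by rw [← hp]
    have e3 : conj (a * b * c) = conj 1 := by rw [h1]
    simp only [Complex.conj_conj, map_mul, map_add, map_ofNat, map_one] at e1 e2 e3
    have e4 : a + b + c = conj a * conj b + conj a * conj c + conj b * conj c := by
      rw [hs] at e2; linear_combination e2 / 6
    have e5 : a * b + a * c + b * c = conj a + conj b + conj c := by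
      rw [hp] at e1; linear_combination e1 / 6
    linear_combination (-conj a) * e4 + conj a ^ 2 * e5 - conj a ^ 3 * h1 - e3
  have hne : (1 : ℂ) - a * conj a ≠ 0 := by
    rw [Complex.mul_conj, sub_ne_zero]
    intro h
    have : (1 : ℝ) = Complex.normSq a := by exact_mod_cast h
    rw [Complex.normSq_eq_norm_sq] at this
    nlinarith
  have hn : ‖a‖ * ‖b‖ * ‖c‖ = 1 := by rw [← norm_mul, ← norm_mul, h1, norm_one]
  have key : ∀ x y : ℂ, 1 - conj a * x = 0 → ‖a‖ * ‖x‖ * ‖y‖ = 1 → 1 ≤ ‖x‖ ∧ ‖y‖ = 1 := by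
    intro x y hx hxy
    have : ‖a‖ * ‖x‖ = 1 := by
      have : conj a * x = 1 := (sub_eq_zero.1 hx).symm
      have := congrArg norm this
      simpa using this
    rw [this, one_mul] at hxy
    exact ⟨by nlinarith [norm_nonneg x], hxy⟩
  rcases mul_eq_zero.1 ((mul_eq_zero.1 hroot).resolve_left hne) with h | h
  · exact Or.inl (key b c h hn)
  · exact Or.inr (key c b h (by linarith))

/-- The zeros in `ζ²` of the derivative of the phase: one lies on the unit circle, the other two lie
on the two sides of it. -/
lemma exists_roots (u : ℂ) : ∃ a b c : ℂ, conj u = 6 * (a + b + c) ∧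
    u = 6 * (a * b + a * c + b * c) ∧ a * b * c = 1 ∧ ‖a‖ = 1 ∧ ‖b‖ ≤ 1 ∧ 1 ≤ ‖c‖ := by
  set P : Cubic ℂ := ⟨6, -conj u, u, -6⟩ with hP
  have ha : P.a ≠ 0 := by simp [hP]
  obtain ⟨x, y, z, h⟩ := (Cubic.splits_iff_roots_eq_three (φ := RingHom.id ℂ) ha).1
    (IsAlgClosed.splits _)
  have e1 := Cubic.b_eq_three_roots ha h
  have e2 := Cubic.c_eq_three_roots ha h
  have e3 := Cubic.d_eq_three_roots ha h
  simp only [hP, RingHom.id_apply] at e1 e2 e3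
  have f1 : conj u = 6 * (x + y + z) := by linear_combination -e1
  have f3 : x * y * z = 1 := by linear_combination e3 / 6
  have hn : ‖x‖ * ‖y‖ * ‖z‖ = 1 := by rw [← norm_mul, ← norm_mul, f3, norm_one]
  by_cases hx : ‖x‖ < 1
  · rcases reflected_root hx f1 e2 f3 with ⟨h1, h2⟩ | ⟨h1, h2⟩
    · exact ⟨z, x, y, by rw [f1]; ring, by rw [e2]; ring, by rw [← f3]; ring, h2, hx.le, h1⟩
    · exact ⟨y, x, z, by rw [f1]; ring, by rw [e2]; ring, by rw [← f3]; ring, h2, hx.le, h1⟩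
  by_cases hy : ‖y‖ < 1
  · rcases reflected_root (a := y) (b := x) (c := z) (u := u) hy (by rw [f1]; ring)
      (by rw [e2]; ring) (by rw [← f3]; ring) with ⟨h1, h2⟩ | ⟨h1, h2⟩
    · exact ⟨z, y, x, by rw [f1]; ring, by rw [e2]; ring, by rw [← f3]; ring, h2, hy.le, h1⟩
    · exact ⟨x, y, z, f1, e2, f3, h2, hy.le, h1⟩
  by_cases hz : ‖z‖ < 1
  · rcases reflected_root (a := z) (b := x) (c := y) (u := u) hz (by rw [f1]; ring)
      (by rw [e2]; ring) (by rw [← f3]; ring) with ⟨h1, h2⟩ | ⟨h1, h2⟩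
    · exact ⟨y, z, x, by rw [f1]; ring, by rw [e2]; ring, by rw [← f3]; ring, h2, hz.le, h1⟩
    · exact ⟨x, z, y, by rw [f1]; ring, by rw [e2]; ring, by rw [← f3]; ring, h2, hz.le, h1⟩
  -- With no root inside the disc, the moduli are all at least `1` and have product `1`, so all
  -- three equal `1`.
  push Not at hx hy hz
  have hxy : 1 ≤ ‖x‖ * ‖y‖ := one_le_mul_of_one_le_of_one_le hx hy
  have hz1 : ‖z‖ = 1 := le_antisymm (by nlinarith) hz
  rw [hz1, mul_one] at hn
  exact ⟨x, y, z, f1, e2, f3, le_antisymm (by nlinarith) hx, by nlinarith, hz⟩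

lemma phaseD_eq_prod {u a b c ζ : ℂ} (hζ : ζ ≠ 0) (hs : conj u = 6 * (a + b + c))
    (hp : u = 6 * (a * b + a * c + b * c)) (h1 : a * b * c = 1) :
    phaseD u ζ * ζ ^ 4 = 3 * ((ζ ^ 2 - a) * (ζ ^ 2 - b) * (ζ ^ 2 - c)) := by
  rw [phaseD, hs]
  nth_rewrite 1 [hp]
  field_simp
  linear_combination 6 * h1

lemma phaseD2_eq_prod {u a b c ζ : ℂ} (hζ : ζ ≠ 0) (hs : conj u = 6 * (a + b + c))
    (hp : u = 6 * (a * b + a * c + b * c)) (h1 : a * b * c = 1) :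
    phaseD2 u ζ * ζ ^ 5 = 6 * ζ ^ 2 * ((ζ ^ 2 - a) * (ζ ^ 2 - b) + (ζ ^ 2 - a) * (ζ ^ 2 - c) +
      (ζ ^ 2 - b) * (ζ ^ 2 - c)) - 4 * (phaseD u ζ * ζ ^ 4) := by
  rw [phaseD_eq_prod hζ hs hp h1, phaseD2]
  nth_rewrite 1 [hp]
  field_simp
  linear_combination (-12) * h1

/-- Of the distances to `s` and `-s` one is at least `|ζ|`, because they add up to at least `2 |ζ|`.
The product of the two thus dominates the other distance times `|ζ|`. -/
lemma exists_norm_mul_le (ζ s : ℂ) : ‖ζ - s‖ * ‖ζ‖ ≤ ‖ζ ^ 2 - s * s‖ ∨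
    ‖ζ - -s‖ * ‖ζ‖ ≤ ‖ζ ^ 2 - s * s‖ := by
  have e : ‖ζ ^ 2 - s * s‖ = ‖ζ - s‖ * ‖ζ - -s‖ := by rw [← norm_mul]; congr 1; ring
  have h : 2 * ‖ζ‖ ≤ ‖ζ - s‖ + ‖ζ - -s‖ := by
    have := norm_add_le (ζ - s) (ζ - -s)
    have e2 : ζ - s + (ζ - -s) = 2 * ζ := by ring
    rwa [e2, norm_mul, RCLike.norm_ofNat] at this
  rw [e]
  rcases le_total ‖ζ‖ ‖ζ - -s‖ with h1 | h1
  · left; gcongr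
  · right; rw [mul_comm]; gcongr; linarith

/-- The stationary points of the phase, together with the bounds from below and above which they
give for its derivatives; all bounds are uniform in `u`. -/
lemma exists_stationary_points (u : ℂ) : ∃ p : Fin 6 → ℂ, ∀ ζ : ℂ, ζ ≠ 0 → ‖ζ‖ ≠ 1 →
    ζ ∉ Set.range p → ∃ j, 0 < ‖ζ - p j‖ ∧ ‖ζ - p j‖ ≤ ‖phaseD u ζ‖ * circWeight ζ ^ 5 ∧
      ‖phaseD2 u ζ‖ ≤ ‖phaseD u ζ‖ * (6 * ‖ζ - p j‖⁻¹ + 4 * circWeight ζ) := by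
  obtain ⟨a, b, c, hs, hp, h1, ha, hb, hc⟩ := exists_roots u
  obtain ⟨sa, rfl⟩ := IsAlgClosed.exists_eq_mul_self a
  obtain ⟨sb, rfl⟩ := IsAlgClosed.exists_eq_mul_self b
  obtain ⟨sc, rfl⟩ := IsAlgClosed.exists_eq_mul_self c
  set p : Fin 6 → ℂ := ![sa, -sa, sb, -sb, sc, -sc] with hpdef
  refine ⟨p, fun ζ h0 hζ1 hζp => ?_⟩
  have hne : ∀ j, ζ - p j ≠ 0 := fun j h => hζp ⟨j, (sub_eq_zero.1 h).symm⟩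
  have hn : 0 < ‖ζ‖ := norm_pos_iff.2 h0
  set d := |‖ζ‖ ^ 2 - 1| with hd
  have hdpos : 0 < d := by
    rw [hd, abs_pos, sub_ne_zero]
    intro h
    exact hζ1 ((pow_eq_one_iff_of_nonneg hn.le two_ne_zero).1 (sub_eq_zero.1 (by linarith)))
  obtain ⟨j, hj⟩ := Finite.exists_min fun j => ‖ζ - p j‖
  have hvpos : 0 < ‖ζ - p j‖ := norm_pos_iff.2 (hne j)
  refine ⟨j, hvpos, ?_, ?_⟩
  · set v := ‖ζ - p j‖ with hv
    have hmin : ∀ s : ℂ, v ≤ ‖ζ - s‖ → v ≤ ‖ζ - -s‖ → v * ‖ζ‖ ≤ ‖ζ ^ 2 - s * s‖ := by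
      intro s k1 k2
      rcases exists_norm_mul_le ζ s with h | h
      · exact le_trans (by gcongr) h
      · exact le_trans (by gcongr) h
    have hB : v * ‖ζ‖ ≤ ‖ζ ^ 2 - sb * sb‖ := hmin sb (hj 2) (hj 3)
    have hC : v * ‖ζ‖ ≤ ‖ζ ^ 2 - sc * sc‖ := hmin sc (hj 4) (hj 5)
    have hdist : ∀ x : ℂ, (‖x‖ ≤ 1 ∧ 1 ≤ ‖ζ‖) ∨ (1 ≤ ‖x‖ ∧ ‖ζ‖ ≤ 1) → d ≤ ‖ζ ^ 2 - x‖ := by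
      rintro x (⟨k1, k2⟩ | ⟨k1, k2⟩)
      · have := norm_sub_norm_le (ζ ^ 2) x
        rw [norm_pow] at this
        rw [hd, abs_of_nonneg (by nlinarith)]
        linarith
      · have := norm_sub_norm_le x (ζ ^ 2)
        rw [norm_pow, norm_sub_rev] at this
        rw [hd, abs_of_nonpos (by nlinarith)]
        linarith
    -- Outside the circle the roots in the closed disc each contribute a factor `d`, and inside it
    -- the roots in the closed exterior do. Only the one remaining factor can be small at a distance
    -- from the circle.
    have hbound : d * d * (v * ‖ζ‖) ≤
        ‖ζ ^ 2 - sa * sa‖ * ‖ζ ^ 2 - sb * sb‖ * ‖ζ ^ 2 - sc * sc‖ := by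
      rcases le_total 1 ‖ζ‖ with k | k
      · have kA := hdist (sa * sa) (Or.inl ⟨ha.le, k⟩)
        have kB := hdist (sb * sb) (Or.inl ⟨hb, k⟩)
        gcongr
      · have kA := hdist (sa * sa) (Or.inr ⟨ha.ge, k⟩)
        have kB := hdist (sc * sc) (Or.inr ⟨hc, k⟩)
        rw [mul_right_comm]
        gcongr
    have hq := congrArg norm (phaseD_eq_prod h0 hs hp h1)
    simp only [norm_mul, norm_pow, RCLike.norm_ofNat] at hq
    have hq' : d ^ 2 * v ≤ ‖phaseD u ζ‖ * ‖ζ‖ ^ 3 := by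
      have hprod : (0:ℝ) ≤ d * d * (v * ‖ζ‖) := by positivity
      have hnorm : ‖phaseD u ζ‖ * ‖ζ‖ ^ 4 =
          3 * (‖ζ ^ 2 - sa * sa‖ * ‖ζ ^ 2 - sb * sb‖ * ‖ζ ^ 2 - sc * sc‖) := by
        rw [hq]
      have : (d ^ 2 * v) * ‖ζ‖ ≤ (‖phaseD u ζ‖ * ‖ζ‖ ^ 3) * ‖ζ‖ := by nlinarith
      exact le_of_mul_le_mul_right this hn
    have hL := inv_abs_le_circWeight ζ
    have hL2 := norm_le_circWeight ζ
    have hL3 := one_le_circWeight ζ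
    have hdL : 1 ≤ d * circWeight ζ := by
      rw [← hd] at hL
      calc 1 = d * d⁻¹ := by field_simp
        _ ≤ _ := by gcongr
    -- The fifth power of the weight arises as `|ζ|³` times `d⁻²`.
    calc v = 1 ^ 2 * v := by ring
      _ ≤ (d * circWeight ζ) ^ 2 * v := by gcongr
      _ = d ^ 2 * v * circWeight ζ ^ 2 := by ring
      _ ≤ ‖phaseD u ζ‖ * ‖ζ‖ ^ 3 * circWeight ζ ^ 2 := by gcongr
      _ ≤ ‖phaseD u ζ‖ * circWeight ζ ^ 3 * circWeight ζ ^ 2 := by gcongr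
      _ = _ := by ring
  · have k0 : ζ - sa ≠ 0 := hne 0
    have k1 : ζ + sa ≠ 0 := by have := hne 1; simpa [hpdef] using this
    have k2 : ζ - sb ≠ 0 := hne 2
    have k3 : ζ + sb ≠ 0 := by have := hne 3; simpa [hpdef] using this
    have k4 : ζ - sc ≠ 0 := hne 4
    have k5 : ζ + sc ≠ 0 := by have := hne 5; simpa [hpdef] using this
    -- Logarithmic derivative of the factorisation of `∂S/∂ζ`. Each of the six simple fractions is
    -- at most the reciprocal distance to the nearest stationary point.
    have e : phaseD2 u ζ = phaseD u ζ * ((∑ i, (ζ - p i)⁻¹) - 4 * ζ⁻¹) := by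
      have hq := phaseD_eq_prod h0 hs hp h1
      have hq2 := phaseD2_eq_prod h0 hs hp h1
      have hq' : phaseD u ζ = 3 * ((ζ ^ 2 - sa * sa) * (ζ ^ 2 - sb * sb) * (ζ ^ 2 - sc * sc)) /
          ζ ^ 4 := by rw [eq_div_iff (by positivity)]; exact hq
      have hsum : (∑ i, (ζ - p i)⁻¹) = 2 * ζ / (ζ ^ 2 - sa * sa) + 2 * ζ / (ζ ^ 2 - sb * sb) +
          2 * ζ / (ζ ^ 2 - sc * sc) := by
        have hpair : ∀ s : ℂ, ζ - s ≠ 0 → ζ + s ≠ 0 →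
            2 * ζ / (ζ ^ 2 - s * s) = (ζ - s)⁻¹ + (ζ - -s)⁻¹ := by
          intro s m1 m2
          have : ζ ^ 2 - s * s = (ζ - s) * (ζ + s) := by ring
          rw [this, sub_neg_eq_add]
          field_simp
          ring
        rw [hpair sa k0 k1, hpair sb k2 k3, hpair sc k4 k5]
        simp [Fin.sum_univ_succ, hpdef]
        ring
      have mA : ζ ^ 2 - sa * sa ≠ 0 := by
        rw [show ζ ^ 2 - sa * sa = (ζ - sa) * (ζ + sa) by ring]; exact mul_ne_zero k0 k1
      have mB : ζ ^ 2 - sb * sb ≠ 0 := by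
        rw [show ζ ^ 2 - sb * sb = (ζ - sb) * (ζ + sb) by ring]; exact mul_ne_zero k2 k3
      have mC : ζ ^ 2 - sc * sc ≠ 0 := by
        rw [show ζ ^ 2 - sc * sc = (ζ - sc) * (ζ + sc) by ring]; exact mul_ne_zero k4 k5
      have h5 : ζ ^ 5 ≠ 0 := pow_ne_zero _ h0
      apply mul_right_cancel₀ h5
      rw [hq2, hsum, hq']
      generalize ζ ^ 2 - sa * sa = A at *
      generalize ζ ^ 2 - sb * sb = B at *
      generalize ζ ^ 2 - sc * sc = D at *
      field_simp
      ring
    rw [e, norm_mul]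
    gcongr
    refine (norm_sub_le _ _).trans (add_le_add ?_ ?_)
    · refine (norm_sum_le _ _).trans ?_
      calc ∑ i, ‖(ζ - p i)⁻¹‖ ≤ ∑ _i : Fin 6, ‖ζ - p j‖⁻¹ := by
            refine Finset.sum_le_sum fun i _ => ?_
            rw [norm_inv]
            exact inv_anti₀ hvpos (hj i)
        _ = 6 * ‖ζ - p j‖⁻¹ := by simp
    · rw [norm_mul, norm_inv, RCLike.norm_ofNat]
      have := inv_norm_le_circWeight ζ
      linarith

/-! ### The coefficient `r` and the oscillating weight. -/

/-- The coefficient of `dζ` in the differential of `scatR b`. -/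
noncomputable def scatRD (b : SchwartzMap ℂ ℂ) (ζ : ℂ) : ℂ :=
  (Real.pi : ℂ) * ((Real.sign (Complex.normSq ζ - 1) : ℝ) : ℂ) * (1 / conj ζ * wirtinger b ζ)

/-- The coefficient of `dζ̄` in the differential of `scatR b`. -/
noncomputable def scatRDBar (b : SchwartzMap ℂ ℂ) (ζ : ℂ) : ℂ :=
  (Real.pi : ℂ) * ((Real.sign (Complex.normSq ζ - 1) : ℝ) : ℂ) *
    (-(1 / conj ζ ^ 2) * b ζ + 1 / conj ζ * wirtingerBar b ζ)

lemma normSq_sub_one_ne_zero {ζ : ℂ} (h : ‖ζ‖ ≠ 1) : Complex.normSq ζ - 1 ≠ 0 := by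
  rw [Complex.normSq_eq_norm_sq, sub_ne_zero]
  exact fun h' => h ((pow_eq_one_iff_of_nonneg (norm_nonneg _) two_ne_zero).1 h')

/-- These values come from the conventions `x / 0 = 0` and `sgn 0 = 0`. They are the true
differential of `r` at these points too, by its quadratic vanishing. -/
lemma scat_eq_zero_of_bad (b : SchwartzMap ℂ ℂ) {ζ : ℂ} (h : ζ = 0 ∨ ‖ζ‖ = 1) :
    scatR b ζ = 0 ∧ scatRD b ζ = 0 ∧ scatRDBar b ζ = 0 := by
  rcases h with rfl | h
  · simp [scatR, scatRD, scatRDBar]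
  · have : Complex.normSq ζ - 1 = 0 := by rw [Complex.normSq_eq_norm_sq, h]; norm_num
    simp [scatR, scatRD, scatRDBar, this]

lemma abs_sign_le_one (x : ℝ) : |Real.sign x| ≤ 1 := by
  rcases Real.sign_apply_eq x with h | h | h <;> rw [h] <;> simp

lemma exists_scat_bound {b : SchwartzMap ℂ ℂ} (hb : IsTransparentScatteringData b) (N : ℕ) :
    ∃ C : ℝ, 0 ≤ C ∧ ∀ ζ : ℂ, ‖scatR b ζ‖ * circWeight ζ ^ N ≤ C ∧
      ‖scatRD b ζ‖ * circWeight ζ ^ N ≤ C ∧ ‖scatRDBar b ζ‖ * circWeight ζ ^ N ≤ C := by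
  -- The worst term is the derivative of `1 / ζ̄`, which costs `|ζ|⁻²` and hence two powers of the
  -- weight.
  obtain ⟨C, hC0, hC⟩ := SchwartzMap.exists_circWeight_bound hb (N + 2)
  refine ⟨2 * Real.pi * C, by positivity, fun ζ => ?_⟩
  by_cases hbad : ζ = 0 ∨ ‖ζ‖ = 1
  · obtain ⟨h1, h2, h3⟩ := scat_eq_zero_of_bad b hbad
    rw [h1, h2, h3]
    simp only [norm_zero, zero_mul]
    exact ⟨by positivity, by positivity, by positivity⟩
  push Not at hbad
  obtain ⟨hb1, hb2⟩ := hC ζ hbad.1 hbad.2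
  set L := circWeight ζ with hL
  have hL1 : 1 ≤ L := one_le_circWeight ζ
  have hL0 : 0 ≤ L := by linarith
  have hi : ‖ζ‖⁻¹ ≤ L := inv_norm_le_circWeight ζ
  set s := Real.sign (Complex.normSq ζ - 1) with hs
  have hs1 : ‖(Real.pi : ℂ) * (s : ℂ)‖ ≤ Real.pi := by
    rw [norm_mul, Complex.norm_real, Complex.norm_real, Real.norm_eq_abs, Real.norm_eq_abs,
      abs_of_pos Real.pi_pos]
    exact mul_le_of_le_one_right Real.pi_pos.le (abs_sign_le_one _)
  have hpow : L ^ (N + 1) ≤ L ^ (N + 2) := pow_le_pow_right₀ hL1 (by omega)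
  have key : ∀ x y : ℝ, 0 ≤ x → x * L ^ (N + 2) ≤ C → y ≤ L * x → y * L ^ N ≤ C := by
    intro x y hx h1 h2
    calc y * L ^ N ≤ (L * x) * L ^ N := by gcongr
      _ = x * L ^ (N + 1) := by ring
      _ ≤ x * L ^ (N + 2) := by gcongr
      _ ≤ C := h1
  have hpi := Real.pi_pos
  refine ⟨?_, ?_, ?_⟩
  · have e : scatR b ζ = ((Real.pi : ℂ) * (s : ℂ)) * ((conj ζ)⁻¹ * b ζ) := by
      rw [scatR, hs]; ring
    rw [e, norm_mul, mul_assoc]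
    have : ‖(conj ζ)⁻¹ * b ζ‖ * L ^ N ≤ C := by
      refine key _ _ (norm_nonneg _) hb1 ?_
      rw [norm_mul, norm_inv, RCLike.norm_conj]
      gcongr
    calc _ ≤ Real.pi * C := by gcongr
      _ ≤ _ := by nlinarith [mul_nonneg hpi.le hC0]
  · rw [scatRD, norm_mul, mul_assoc]
    have : ‖1 / conj ζ * wirtinger b ζ‖ * L ^ N ≤ C := by
      refine key _ _ (norm_nonneg _) hb2 ?_
      rw [norm_mul, norm_div, norm_one, one_div, RCLike.norm_conj]
      gcongr
      exact norm_wirtinger_le _ _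
    calc _ ≤ Real.pi * C := by gcongr
      _ ≤ _ := by nlinarith [mul_nonneg hpi.le hC0]
  · rw [scatRDBar, norm_mul, mul_assoc]
    have h1 : ‖1 / conj ζ * wirtingerBar b ζ‖ * L ^ N ≤ C := by
      refine key _ _ (norm_nonneg _) hb2 ?_
      rw [norm_mul, norm_div, norm_one, one_div, RCLike.norm_conj]
      gcongr
      exact norm_wirtingerBar_le _ _
    have h2 : ‖-(1 / conj ζ ^ 2) * b ζ‖ * L ^ N ≤ C := by
      have : ‖-(1 / conj ζ ^ 2) * b ζ‖ ≤ L ^ 2 * ‖b ζ‖ := by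
        rw [norm_mul, norm_neg, norm_div, norm_one, one_div, norm_pow, RCLike.norm_conj, ← inv_pow]
        gcongr
      calc _ ≤ (L ^ 2 * ‖b ζ‖) * L ^ N := by gcongr
        _ = ‖b ζ‖ * L ^ (N + 2) := by ring
        _ ≤ C := hb1
    have h3 := norm_add_le (-(1 / conj ζ ^ 2) * b ζ) (1 / conj ζ * wirtingerBar b ζ)
    calc _ ≤ Real.pi * ((‖-(1 / conj ζ ^ 2) * b ζ‖ + ‖1 / conj ζ * wirtingerBar b ζ‖) * L ^ N) := by
          gcongr
      _ ≤ Real.pi * (C + C) := by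
          gcongr
          rw [add_mul]; exact add_le_add h2 h1
      _ = _ := by ring

lemma hasWirt_scatR (b : SchwartzMap ℂ ℂ) {ζ : ℂ} (h0 : ζ ≠ 0) (h1 : ‖ζ‖ ≠ 1) :
    HasWirt (scatR b) (scatRD b ζ) (scatRDBar b ζ) ζ := by
  have hsign : ∀ᶠ x in nhds ζ,
      Real.sign (Complex.normSq x - 1) = Real.sign (Complex.normSq ζ - 1) := by
    have hc : Continuous fun x : ℂ => Complex.normSq x - 1 := by fun_prop
    rcases lt_or_gt_of_ne (normSq_sub_one_ne_zero h1) with h | h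
    · filter_upwards [hc.continuousAt.eventually (gt_mem_nhds h)] with x hx
      rw [Real.sign_of_neg h, Real.sign_of_neg hx]
    · filter_upwards [hc.continuousAt.eventually (lt_mem_nhds h)] with x hx
      rw [Real.sign_of_pos h, Real.sign_of_pos hx]
  have hinv : HasWirt (fun x => 1 / conj x) 0 (-(1 / conj ζ ^ 2)) ζ := by
    have := ((hasDerivAt_inv h0).hasWirt).conj
    refine (this.congr_coeff (by simp) (by simp)).congr_of_eventuallyEq
      (Eventually.of_forall fun x => by simp)
  have hbd : HasWirt b (wirtinger b ζ) (wirtingerBar b ζ) ζ :=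
    (b.differentiableAt).hasWirt
  have := (hasWirt_const
    ((Real.pi : ℂ) * ((Real.sign (Complex.normSq ζ - 1) : ℝ) : ℂ)) ζ).mul (hinv.mul hbd)
  refine (this.congr_coeff ?_ ?_).congr_of_eventuallyEq ?_
  · simp [scatRD]
  · simp [scatRDBar]
  · filter_upwards [hsign] with x hx
    rw [scatR, hx]; ring

/-- Near such a point the distance to it times `circWeight` is bounded below, so decay against the
square of the weight is quadratic vanishing. It makes `r` differentiable across the circle in spite
of the jump of the sign. -/
lemma exists_scatR_le_sq {b : SchwartzMap ℂ ℂ} (hb : IsTransparentScatteringData b) {ζ : ℂ}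
    (h : ζ = 0 ∨ ‖ζ‖ = 1) : ∃ C : ℝ, ∀ᶠ x in nhds ζ, ‖scatR b x‖ ≤ C * ‖x - ζ‖ ^ 2 := by
  obtain ⟨C, hC0, hC⟩ := exists_scat_bound hb 2
  have key : ∀ (x : ℂ) (K y : ℝ), 0 ≤ y → 1 ≤ K * y * circWeight x →
      ‖scatR b x‖ ≤ (C * K ^ 2) * y ^ 2 := by
    intro x K y hy h
    calc ‖scatR b x‖ = ‖scatR b x‖ * 1 ^ 2 := by ring
      _ ≤ ‖scatR b x‖ * (K * y * circWeight x) ^ 2 := by gcongr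
      _ = (‖scatR b x‖ * circWeight x ^ 2) * (K * y) ^ 2 := by ring
      _ ≤ C * (K * y) ^ 2 := by gcongr; exact (hC x).1
      _ = _ := by ring
  rcases h with rfl | h
  · refine ⟨C * 1 ^ 2, Eventually.of_forall fun x => ?_⟩
    rw [sub_zero]
    by_cases hx : x = 0
    · rw [(scat_eq_zero_of_bad b (Or.inl hx)).1, norm_zero]; positivity
    refine key x 1 ‖x‖ (norm_nonneg _) ?_
    have hn : 0 < ‖x‖ := norm_pos_iff.2 hx
    calc (1 : ℝ) = 1 * ‖x‖ * ‖x‖⁻¹ := by field_simp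
      _ ≤ _ := by gcongr; exact inv_norm_le_circWeight x
  · refine ⟨C * 3 ^ 2, ?_⟩
    filter_upwards [Metric.ball_mem_nhds ζ one_pos] with x hx
    by_cases hx1 : ‖x‖ = 1
    · rw [(scat_eq_zero_of_bad b (Or.inr hx1)).1, norm_zero]; positivity
    refine key x 3 ‖x - ζ‖ (norm_nonneg _) ?_
    rw [Metric.mem_ball, dist_eq_norm] at hx
    have h1 : |‖x‖ - ‖ζ‖| ≤ ‖x - ζ‖ := abs_norm_sub_norm_le x ζ
    rw [h] at h1
    have h2 : ‖x‖ ≤ 2 := by have := (abs_le.1 h1).2; linarith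
    have h3 : |‖x‖ ^ 2 - 1| ≤ 3 * ‖x - ζ‖ := by
      have : ‖x‖ ^ 2 - 1 = (‖x‖ + 1) * (‖x‖ - 1) := by ring
      rw [this, abs_mul, abs_of_nonneg (by positivity)]
      gcongr
      linarith
    have h4 : 0 < |‖x‖ ^ 2 - 1| := by
      rw [abs_pos, sub_ne_zero]
      exact fun h' => hx1 ((pow_eq_one_iff_of_nonneg (norm_nonneg _) two_ne_zero).1 h')
    calc (1 : ℝ) = |‖x‖ ^ 2 - 1| * |‖x‖ ^ 2 - 1|⁻¹ := by field_simp
      _ ≤ _ := by gcongr; exact inv_abs_le_circWeight x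

lemma circWeight_inv_pow_le (ζ : ℂ) : (circWeight ζ ^ 3)⁻¹ ≤ planeWeight ζ := by
  unfold planeWeight
  have := one_add_norm_le_circWeight ζ
  gcongr

lemma norm_le_planeWeight_of_circWeight {X C : ℝ} {ζ : ℂ} (hC : 0 ≤ C)
    (h : X * circWeight ζ ^ 3 ≤ C) : X ≤ C * planeWeight ζ := by
  have hp : 0 < circWeight ζ ^ 3 := by have := one_le_circWeight ζ; positivity
  calc X ≤ C * (circWeight ζ ^ 3)⁻¹ := by
        rw [← div_eq_mul_inv, le_div_iff₀ hp]; exact h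
    _ ≤ _ := by gcongr; exact circWeight_inv_pow_le ζ

lemma norm_exp_phaseS (t : ℝ) (u ζ : ℂ) :
    ‖Complex.exp (Complex.I * (t : ℂ) * phaseS u ζ)‖ = 1 := by
  rw [phaseS_eq, Complex.add_conj, Complex.norm_exp]
  simp

lemma norm_oscWeight (b : SchwartzMap ℂ ℂ) (z : ℂ) (t : ℝ) (ζ : ℂ) :
    ‖oscWeight b z t ζ‖ = ‖scatR b ζ‖ := by
  rw [oscWeight, norm_mul, norm_exp_phaseS, mul_one]

lemma measurable_oscWeight (b : SchwartzMap ℂ ℂ) (z : ℂ) (t : ℝ) :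
    Measurable (oscWeight b z t) := by
  have hsign : Measurable Real.sign := by
    unfold Real.sign
    exact Measurable.ite measurableSet_Iio measurable_const
      (Measurable.ite measurableSet_Ioi measurable_const measurable_const)
  have hconj : Measurable (fun x : ℂ => conj x) := Complex.continuous_conj.measurable
  have hb : Measurable b := b.continuous.measurable
  have h1 : Measurable fun ζ : ℂ => Real.sign (Complex.normSq ζ - 1) :=
    hsign.comp (by fun_prop)
  unfold oscWeight scatR phaseS
  fun_prop

lemma exists_oscWeight_bound {b : SchwartzMap ℂ ℂ} (hb : IsTransparentScatteringData b) :
    ∃ C : ℝ, 0 ≤ C ∧ ∀ (z : ℂ) (t : ℝ) (ζ : ℂ), ‖oscWeight b z t ζ‖ ≤ C * planeWeight ζ := by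
  obtain ⟨C, hC0, hC⟩ := exists_scat_bound hb 3
  refine ⟨C, hC0, fun z t ζ => ?_⟩
  rw [norm_oscWeight]
  exact norm_le_planeWeight_of_circWeight hC0 (hC ζ).1

lemma hasWirt_exp_phaseS (t : ℝ) (u : ℂ) {ζ : ℂ} (h : ζ ≠ 0) :
    HasWirt (fun x => Complex.exp (Complex.I * (t : ℂ) * phaseS u x))
      (Complex.exp (Complex.I * (t : ℂ) * phaseS u ζ) * (Complex.I * t) * phaseD u ζ)
      (Complex.exp (Complex.I * (t : ℂ) * phaseS u ζ) * (Complex.I * t) * conj (phaseD u ζ)) ζ := by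
  have h1 := (hasDerivAt_phaseH u h).hasWirt
  have h2 : HasWirt (phaseS u) (phaseD u ζ) (conj (phaseD u ζ)) ζ :=
    ((h1.add h1.conj).congr_coeff (by simp) (by simp)).congr_of_eventuallyEq
      (Eventually.of_forall fun x => phaseS_eq u x)
  have h3 : HasDerivAt (fun y => Complex.exp (Complex.I * (t : ℂ) * y))
      (Complex.exp (Complex.I * (t : ℂ) * phaseS u ζ) * (Complex.I * t)) (phaseS u ζ) := by
    have := ((hasDerivAt_id (phaseS u ζ)).const_mul (Complex.I * (t : ℂ))).cexp
    simpa using this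
  exact h3.comp_hasWirt h2

/-! ### The regularised reciprocal of `∂S/∂ζ` and the stationary phase bound. -/

/-- The regularisation of the reciprocal of `∂S/∂ζ` at scale `δ`. -/
noncomputable def chi (u : ℂ) (δ : ℝ) (ζ : ℂ) : ℂ :=
  conj (phaseD u ζ) * ((‖phaseD u ζ‖ ^ 2 + δ ^ 2 : ℝ) : ℂ)⁻¹

/-- The coefficient of `dζ` in the differential of `chi u δ`. -/
noncomputable def chiD (u : ℂ) (δ : ℝ) (ζ : ℂ) : ℂ :=
  conj (phaseD u ζ) * (-(phaseD2 u ζ * conj (phaseD u ζ)) /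
    ((‖phaseD u ζ‖ ^ 2 + δ ^ 2 : ℝ) : ℂ) ^ 2)

/-- The coefficient of `dζ̄` in the differential of `chi u δ`. -/
noncomputable def chiDBar (u : ℂ) (δ : ℝ) (ζ : ℂ) : ℂ :=
  conj (phaseD2 u ζ) * ((‖phaseD u ζ‖ ^ 2 + δ ^ 2 : ℝ) : ℂ)⁻¹ +
  conj (phaseD u ζ) * (-(phaseD u ζ * conj (phaseD2 u ζ)) /
    ((‖phaseD u ζ‖ ^ 2 + δ ^ 2 : ℝ) : ℂ) ^ 2)

lemma hasWirt_chi (u : ℂ) {δ : ℝ} (hδ : 0 < δ) {ζ : ℂ} (h : ζ ≠ 0) :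
    HasWirt (chi u δ) (chiD u δ ζ) (chiDBar u δ ζ) ζ := by
  have hq := (hasDerivAt_phaseD u h).hasWirt
  have hne : ((‖phaseD u ζ‖ ^ 2 + δ ^ 2 : ℝ) : ℂ) ≠ 0 := by
    have : (0:ℝ) < ‖phaseD u ζ‖ ^ 2 + δ ^ 2 := by positivity
    exact_mod_cast this.ne'
  have hD : HasWirt (fun x => ((‖phaseD u x‖ ^ 2 + δ ^ 2 : ℝ) : ℂ))
      (phaseD2 u ζ * conj (phaseD u ζ)) (phaseD u ζ * conj (phaseD2 u ζ)) ζ := by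
    refine (((hq.mul hq.conj).add (hasWirt_const ((δ : ℂ) ^ 2) ζ)).congr_coeff
      (by simp) (by simp)).congr_of_eventuallyEq (Eventually.of_forall fun x => ?_)
    simp only [Complex.mul_conj, Complex.normSq_eq_norm_sq]
    push_cast; ring
  have hinv := (hasDerivAt_inv hne).comp_hasWirt hD
  refine (hq.conj.mul hinv).congr_coeff ?_ ?_
  · simp only [map_zero, zero_mul, zero_add, chiD]
    ring
  · simp only [chiDBar]
    ring

lemma norm_chi (u : ℂ) (δ : ℝ) (ζ : ℂ) :
    ‖chi u δ ζ‖ = ‖phaseD u ζ‖ / (‖phaseD u ζ‖ ^ 2 + δ ^ 2) := by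
  rw [chi, norm_mul, norm_inv, Complex.norm_real, RCLike.norm_conj, Real.norm_of_nonneg
    (by positivity)]
  rfl

lemma norm_chiD (u : ℂ) (δ : ℝ) (ζ : ℂ) :
    ‖chiD u δ ζ‖ = ‖phaseD2 u ζ‖ * ‖phaseD u ζ‖ ^ 2 / (‖phaseD u ζ‖ ^ 2 + δ ^ 2) ^ 2 := by
  rw [chiD, norm_mul, norm_div, norm_neg, norm_mul, norm_pow, Complex.norm_real, RCLike.norm_conj,
    Real.norm_of_nonneg (by positivity)]
  ring

/-- A crude bound, like those that follow for the derivatives of `χ` and of the phase: they depend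
on `δ` or `u` and serve only to justify differentiation and integrability, so they never enter the
final constants. -/
lemma norm_chi_le (u : ℂ) {δ : ℝ} (hδ : 0 < δ) (ζ : ℂ) : ‖chi u δ ζ‖ ≤ δ⁻¹ := by
  rw [norm_chi, inv_eq_one_div, div_le_div_iff₀ (by positivity) hδ]
  nlinarith [sq_nonneg (‖phaseD u ζ‖ - δ), sq_nonneg ‖phaseD u ζ‖, sq_nonneg δ]

lemma norm_chiD_le (u : ℂ) {δ : ℝ} (hδ : 0 < δ) (ζ : ℂ) :
    ‖chiD u δ ζ‖ ≤ ‖phaseD2 u ζ‖ * (δ ^ 2)⁻¹ := by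
  rw [norm_chiD, mul_div_assoc]
  gcongr
  rw [inv_eq_one_div, div_le_div_iff₀ (by positivity) (by positivity)]
  nlinarith [sq_nonneg (‖phaseD u ζ‖ ^ 2), sq_nonneg (δ ^ 2),
    mul_nonneg (sq_nonneg ‖phaseD u ζ‖) (sq_nonneg δ)]

lemma norm_chiDBar_le (u : ℂ) {δ : ℝ} (hδ : 0 < δ) (ζ : ℂ) :
    ‖chiDBar u δ ζ‖ ≤ 2 * (‖phaseD2 u ζ‖ * (δ ^ 2)⁻¹) := by
  have h1 : ‖conj (phaseD2 u ζ) * ((‖phaseD u ζ‖ ^ 2 + δ ^ 2 : ℝ) : ℂ)⁻¹‖ ≤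
      ‖phaseD2 u ζ‖ * (δ ^ 2)⁻¹ := by
    rw [norm_mul, norm_inv, Complex.norm_real, RCLike.norm_conj, Real.norm_of_nonneg
      (by positivity)]
    gcongr
    nlinarith [sq_nonneg ‖phaseD u ζ‖]
  have h2 : ‖conj (phaseD u ζ) * (-(phaseD u ζ * conj (phaseD2 u ζ)) /
      ((‖phaseD u ζ‖ ^ 2 + δ ^ 2 : ℝ) : ℂ) ^ 2)‖ ≤ ‖phaseD2 u ζ‖ * (δ ^ 2)⁻¹ := by
    refine le_trans (le_of_eq ?_) (norm_chiD_le u hδ ζ)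
    rw [chiD]
    simp only [norm_mul, norm_div, norm_neg, RCLike.norm_conj, norm_pow]
    ring
  rw [chiDBar]
  exact (norm_add_le _ _).trans (by linarith)

lemma norm_phaseD_le (u : ℂ) (ζ : ℂ) : ‖phaseD u ζ‖ ≤ (‖u‖ + 18) * circWeight ζ ^ 5 := by
  have hL1 := one_le_circWeight ζ
  have hn := norm_le_circWeight ζ
  have hi := inv_norm_le_circWeight ζ
  have hu := norm_nonneg u
  set L := circWeight ζ
  have p0 : 1 ≤ L ^ 5 := one_le_pow₀ hL1
  have p2 : L ^ 2 ≤ L ^ 5 := pow_le_pow_right₀ hL1 (by norm_num)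
  have p4 : L ^ 4 ≤ L ^ 5 := pow_le_pow_right₀ hL1 (by norm_num)
  have i2 : ‖ζ‖⁻¹ ^ 2 ≤ L ^ 5 := le_trans (by gcongr) p2
  have i4 : ‖ζ‖⁻¹ ^ 4 ≤ L ^ 5 := le_trans (by gcongr) p4
  have n2 : ‖ζ‖ ^ 2 ≤ L ^ 5 := le_trans (by gcongr) p2
  have e : phaseD u ζ = -(1 / 2) * conj u + 1 / 2 * (u * ζ⁻¹ ^ 2) + 3 * ζ ^ 2 + -3 * ζ⁻¹ ^ 4 := by
    rw [phaseD]; ring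
  rw [e]
  refine (norm_add₄_le).trans ?_
  simp only [norm_mul, norm_neg, norm_div, norm_one, RCLike.norm_ofNat, RCLike.norm_conj, norm_pow,
    norm_inv]
  nlinarith [mul_le_mul_of_nonneg_left i2 hu, mul_le_mul_of_nonneg_left p0 hu]

lemma norm_phaseD2_le (u : ℂ) (ζ : ℂ) : ‖phaseD2 u ζ‖ ≤ (‖u‖ + 18) * circWeight ζ ^ 5 := by
  have hL1 := one_le_circWeight ζ
  have hn := norm_le_circWeight ζ
  have hi := inv_norm_le_circWeight ζ
  have hu := norm_nonneg u
  set L := circWeight ζ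
  have p1 : L ≤ L ^ 5 := le_self_pow₀ hL1 (by norm_num)
  have p3 : L ^ 3 ≤ L ^ 5 := pow_le_pow_right₀ hL1 (by norm_num)
  have i3 : ‖ζ‖⁻¹ ^ 3 ≤ L ^ 5 := le_trans (by gcongr) p3
  have i5 : ‖ζ‖⁻¹ ^ 5 ≤ L ^ 5 := by gcongr
  have e : phaseD2 u ζ = -u * ζ⁻¹ ^ 3 + 6 * ζ + 12 * ζ⁻¹ ^ 5 := by
    rw [phaseD2]; ring
  rw [e]
  refine (norm_add₃_le).trans ?_
  simp only [norm_mul, norm_neg, RCLike.norm_ofNat, norm_pow, norm_inv]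
  nlinarith [mul_le_mul_of_nonneg_left i3 hu]

/-- The bounds for the regularised reciprocal near a simple zero of `∂S/∂ζ`. -/
lemma regularized_bounds {X Y L v δ : ℝ} (hX : 0 ≤ X) (hL : 1 ≤ L) (hv : 0 < v)
    (hδ : 0 < δ) (h1 : v ≤ X * L ^ 5) (h2 : Y ≤ X * (6 * v⁻¹ + 4 * L)) :
    (X ^ 2 + δ ^ 2)⁻¹ ≤ 20 * L ^ 10 * (1 + (v * (v + δ))⁻¹) ∧
    X / (X ^ 2 + δ ^ 2) ≤ 20 * L ^ 10 * (1 + (v * (v + δ))⁻¹) ∧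
    Y * X ^ 2 / (X ^ 2 + δ ^ 2) ^ 2 ≤ 20 * L ^ 10 * (1 + (v * (v + δ))⁻¹) := by
  have hD : 0 < X ^ 2 + δ ^ 2 := by positivity
  have hP : 0 < v * (v + δ) := by positivity
  have hL0 : 0 < L := by linarith
  have p5 : L ^ 5 ≤ L ^ 10 := pow_le_pow_right₀ hL (by norm_num)
  have p6 : L ^ 6 ≤ L ^ 10 := pow_le_pow_right₀ hL (by norm_num)
  have p05 : 1 ≤ L ^ 5 := one_le_pow₀ hL
  have p10 : 1 ≤ L ^ 10 := one_le_pow₀ hL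
  have hT : 0 < (v * (v + δ))⁻¹ := by positivity
  have hinv : (v + δ)⁻¹ ≤ 1 + (v * (v + δ))⁻¹ := by
    rcases le_total v 1 with h | h
    · have : (v + δ)⁻¹ ≤ (v * (v + δ))⁻¹ :=
        inv_anti₀ hP (mul_le_of_le_one_left (by positivity) h)
      linarith
    · have : (v + δ)⁻¹ ≤ 1 := inv_le_one_of_one_le₀ (by linarith)
      linarith
  -- The bound for `X v` uses the simple-zero estimate, the one for `X δ` the arithmetic-geometric
  -- mean inequality.
  have hchi : X / (X ^ 2 + δ ^ 2) ≤ 2 * L ^ 5 * (v + δ)⁻¹ := by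
    rw [← div_eq_mul_inv, div_le_div_iff₀ hD (by positivity)]
    have a1 : X * v ≤ X ^ 2 * L ^ 5 := by nlinarith
    have a2 : X * δ ≤ X ^ 2 + δ ^ 2 := by nlinarith [sq_nonneg (X - δ)]
    have a3 : X ^ 2 + δ ^ 2 ≤ L ^ 5 * (X ^ 2 + δ ^ 2) := le_mul_of_one_le_left hD.le p05
    nlinarith [mul_nonneg (sq_nonneg δ) (zero_le_one.trans p05)]
  refine ⟨?_, ?_, ?_⟩
  · have : (X ^ 2 + δ ^ 2)⁻¹ ≤ 2 * L ^ 10 * (v * (v + δ))⁻¹ := by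
      rw [← div_eq_mul_inv, inv_eq_one_div, div_le_div_iff₀ hD hP, one_mul]
      have a1 : v ^ 2 ≤ X ^ 2 * L ^ 10 := by
        calc v ^ 2 ≤ (X * L ^ 5) ^ 2 := by gcongr
          _ = _ := by ring
      have a2 : v * δ ≤ (v ^ 2 + δ ^ 2) / 2 := by nlinarith [sq_nonneg (v - δ)]
      have a3 : δ ^ 2 ≤ L ^ 10 * δ ^ 2 := le_mul_of_one_le_left (by positivity) p10
      nlinarith
    nlinarith [mul_pos (zero_lt_one.trans_le p10) hT]
  · calc X / (X ^ 2 + δ ^ 2) ≤ 2 * L ^ 5 * (v + δ)⁻¹ := hchi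
      _ ≤ 20 * L ^ 10 * (1 + (v * (v + δ))⁻¹) := by
          gcongr
          norm_num
  · have hXr : X ^ 2 / (X ^ 2 + δ ^ 2) ≤ 1 := by
      rw [div_le_one hD]; nlinarith [sq_nonneg δ]
    have hs : 0 ≤ 6 * v⁻¹ + 4 * L := by positivity
    calc Y * X ^ 2 / (X ^ 2 + δ ^ 2) ^ 2
        ≤ (X * (6 * v⁻¹ + 4 * L)) * X ^ 2 / (X ^ 2 + δ ^ 2) ^ 2 := by gcongr
      _ = (X / (X ^ 2 + δ ^ 2)) * (X ^ 2 / (X ^ 2 + δ ^ 2)) * (6 * v⁻¹ + 4 * L) := by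
          field_simp
      _ ≤ (2 * L ^ 5 * (v + δ)⁻¹) * 1 * (6 * v⁻¹ + 4 * L) := by gcongr
      _ = 12 * L ^ 5 * (v * (v + δ))⁻¹ + 8 * L ^ 6 * (v + δ)⁻¹ := by
          rw [mul_inv]; ring
      _ ≤ 12 * L ^ 10 * (1 + (v * (v + δ))⁻¹) + 8 * L ^ 10 * (1 + (v * (v + δ))⁻¹) := by
          gcongr
          linarith
      _ = _ := by ring

/-- Integration by parts against the regularised reciprocal of `∂S/∂ζ`: the remaining integrand is
integrable and has the same integral. -/
lemma integral_oscWeight_eq {b : SchwartzMap ℂ ℂ} (hb : IsTransparentScatteringData b)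
    {z : ℂ} {t : ℝ} (ht : t ≠ 0) {δ : ℝ} (hδ : 0 < δ) {G Ga Gb : ℂ → ℂ} {M M' : ℝ}
    (hG : ∀ ζ, HasWirt G (Ga ζ) (Gb ζ) ζ) (hGM : ∀ ζ, ‖G ζ‖ ≤ M) (hGa : ∀ ζ, ‖Ga ζ‖ ≤ M)
    (hGb : ∀ ζ, ‖Gb ζ‖ ≤ M') :
    ∃ P : ℂ → ℂ, ∫ ζ, oscWeight b z t ζ * G ζ = ∫ ζ, P ζ ∧ ∀ ζ,
      ‖P ζ‖ ≤ M * ‖scatR b ζ‖ * δ ^ 2 * (‖phaseD (z / t) ζ‖ ^ 2 + δ ^ 2)⁻¹ + M * |t|⁻¹ *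
        (‖scatRD b ζ‖ * ‖chi (z / t) δ ζ‖ + ‖scatR b ζ‖ * ‖chiD (z / t) δ ζ‖ +
          ‖scatR b ζ‖ * ‖chi (z / t) δ ζ‖) := by
  set u := z / t with hu
  set E : ℂ → ℂ := fun ζ => Complex.exp (Complex.I * (t : ℂ) * phaseS u ζ) with hE
  have hEn : ∀ ζ, ‖E ζ‖ = 1 := fun ζ => norm_exp_phaseS t u ζ
  have hM : 0 ≤ M := (norm_nonneg _).trans (hGM 0)
  have hM' : 0 ≤ M' := (norm_nonneg _).trans (hGb 0)
  have hGc : Continuous G := continuous_iff_continuousAt.2 fun ζ => (hG ζ).continuousAt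
  have htc : (t : ℂ) ≠ 0 := by exact_mod_cast ht
  have hIt : ‖Complex.I * (t : ℂ)‖ = |t| := by
    rw [norm_mul, Complex.norm_I, one_mul, Complex.norm_real, Real.norm_eq_abs]
  -- The function whose `∂/∂ζ` derivative `a` is integrated to zero. The exponential contributes `i
  -- t (∂S/∂ζ) χ` times the original integrand, which nearly reproduces it after division by `i t`.
  set F : ℂ → ℂ := fun ζ => scatR b ζ * chi u δ ζ * G ζ * E ζ with hF
  set a : ℂ → ℂ := fun ζ =>
    ((scatRD b ζ * chi u δ ζ + scatR b ζ * chiD u δ ζ) * G ζ + scatR b ζ * chi u δ ζ * Ga ζ) * E ζ +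
      scatR b ζ * chi u δ ζ * G ζ * (E ζ * (Complex.I * t) * phaseD u ζ) with ha
  set c : ℂ → ℂ := fun ζ =>
    ((scatRDBar b ζ * chi u δ ζ + scatR b ζ * chiDBar u δ ζ) * G ζ +
      scatR b ζ * chi u δ ζ * Gb ζ) * E ζ +
      scatR b ζ * chi u δ ζ * G ζ * (E ζ * (Complex.I * t) * conj (phaseD u ζ)) with hc
  have hFn : ∀ ζ, ‖F ζ‖ ≤ (δ⁻¹ * M) * ‖scatR b ζ‖ := by
    intro ζ
    simp only [hF, norm_mul, hEn, mul_one]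
    calc ‖scatR b ζ‖ * ‖chi u δ ζ‖ * ‖G ζ‖ ≤ ‖scatR b ζ‖ * δ⁻¹ * M := by
          gcongr
          · exact norm_chi_le u hδ ζ
          · exact hGM ζ
      _ = _ := by ring
  have hFW : ∀ ζ, HasWirt F (a ζ) (c ζ) ζ := by
    intro ζ
    by_cases hbad : ζ = 0 ∨ ‖ζ‖ = 1
    · obtain ⟨h1, h2, h3⟩ := scat_eq_zero_of_bad b hbad
      obtain ⟨C, hC⟩ := exists_scatR_le_sq hb hbad
      refine (hasWirt_zero_of_sq_bound (C := δ⁻¹ * M * C) ?_ ?_).congr_coeff ?_ ?_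
      · simp [hF, h1]
      · filter_upwards [hC] with x hx
        calc ‖F x‖ ≤ (δ⁻¹ * M) * ‖scatR b x‖ := hFn x
          _ ≤ (δ⁻¹ * M) * (C * ‖x - ζ‖ ^ 2) := by gcongr
          _ = _ := by ring
      · simp [ha, h1, h2]
      · simp [hc, h1, h3]
    · push Not at hbad
      exact (((hasWirt_scatR b hbad.1 hbad.2).mul (hasWirt_chi u hδ hbad.1)).mul (hG ζ)).mul
        (hasWirt_exp_phaseS t u hbad.1)
  -- Five powers absorb the growth of the derivatives of the phase, three yield `planeWeight`. The
  -- constant `K` below may depend on all parameters, `M'` included, since it gives integrability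
  -- only.
  obtain ⟨C, hC0, hC⟩ := exists_scat_bound hb 8
  set Q := ‖u‖ + 18 with hQ
  have hQ0 : 0 ≤ Q := by positivity
  set K : ℝ := C * (δ⁻¹ * M + 2 * (Q * (δ ^ 2)⁻¹) * M + δ⁻¹ * M + δ⁻¹ * M' +
    δ⁻¹ * M * (|t| * Q)) with hK
  have hK0 : 0 ≤ K := by positivity
  have hpoint : ∀ (ζ r' χ' g' q' : ℂ) , ‖r'‖ * circWeight ζ ^ 8 ≤ C →
      ‖χ'‖ ≤ 2 * (‖phaseD2 u ζ‖ * (δ ^ 2)⁻¹) → ‖g'‖ ≤ M + M' → ‖q'‖ = ‖phaseD u ζ‖ →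
      ‖((r' * chi u δ ζ + scatR b ζ * χ') * G ζ + scatR b ζ * chi u δ ζ * g') * E ζ +
      scatR b ζ * chi u δ ζ * G ζ * (E ζ * (Complex.I * t) * q')‖ ≤ K * planeWeight ζ := by
    intro ζ r' χ' g' q' hr' hχ' hg' hq'
    have hL1 := one_le_circWeight ζ
    set L := circWeight ζ with hL
    have hL0 : 0 < L := by linarith
    have hL5 : 1 ≤ L ^ 5 := one_le_pow₀ hL1
    apply norm_le_planeWeight_of_circWeight hK0
    have hr := (hC ζ).1
    have e1 : ‖r' * chi u δ ζ * G ζ‖ ≤ ‖r'‖ * (δ⁻¹ * M) := by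
      rw [norm_mul, norm_mul, mul_assoc]
      gcongr
      · exact norm_chi_le u hδ ζ
      · exact hGM ζ
    have e2 : ‖scatR b ζ * χ' * G ζ‖ ≤ ‖scatR b ζ‖ * (2 * (Q * L ^ 5 * (δ ^ 2)⁻¹) * M) := by
      rw [norm_mul, norm_mul, mul_assoc]
      gcongr
      · refine hχ'.trans ?_
        gcongr
        exact norm_phaseD2_le u ζ
      · exact hGM ζ
    have e3 : ‖scatR b ζ * chi u δ ζ * g'‖ ≤ ‖scatR b ζ‖ * (δ⁻¹ * (M + M')) := by
      rw [norm_mul, norm_mul, mul_assoc]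
      gcongr
      exact norm_chi_le u hδ ζ
    have e4 : ‖scatR b ζ * chi u δ ζ * G ζ * (E ζ * (Complex.I * t) * q')‖ ≤
        ‖scatR b ζ‖ * (δ⁻¹ * M * (|t| * (Q * L ^ 5))) := by
      rw [norm_mul, norm_mul, norm_mul, norm_mul (E ζ * _), norm_mul (E ζ), hEn, hIt, hq', one_mul,
        mul_assoc, mul_assoc, mul_assoc]
      gcongr
      · exact norm_chi_le u hδ ζ
      · exact hGM ζ
      · exact norm_phaseD_le u ζ
    have etot : ‖((r' * chi u δ ζ + scatR b ζ * χ') * G ζ + scatR b ζ * chi u δ ζ * g') * E ζ +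
        scatR b ζ * chi u δ ζ * G ζ * (E ζ * (Complex.I * t) * q')‖ ≤
        ‖r' * chi u δ ζ * G ζ‖ + ‖scatR b ζ * χ' * G ζ‖ + ‖scatR b ζ * chi u δ ζ * g'‖ +
        ‖scatR b ζ * chi u δ ζ * G ζ * (E ζ * (Complex.I * t) * q')‖ := by
      refine (norm_add_le _ _).trans ?_
      gcongr
      rw [norm_mul, hEn, mul_one, add_mul]
      exact norm_add₃_le
    have hmul : ∀ x y w : ℝ, 0 ≤ y → 0 ≤ x → x * L ^ 8 ≤ C → w ≤ x * (y * L ^ 5) →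
        w * L ^ 3 ≤ C * y := by
      intro x y w hy hx h1 h2
      calc w * L ^ 3 ≤ x * (y * L ^ 5) * L ^ 3 := by gcongr
        _ = (x * L ^ 8) * y := by ring
        _ ≤ C * y := by gcongr
    have f1 := hmul ‖r'‖ (δ⁻¹ * M) _ (by positivity) (norm_nonneg _) hr'
      (e1.trans (mul_le_mul_of_nonneg_left (le_mul_of_one_le_right (by positivity) hL5)
        (norm_nonneg _)))
    have f2 := hmul ‖scatR b ζ‖ (2 * (Q * (δ ^ 2)⁻¹) * M) _ (by positivity) (norm_nonneg _) hr
      (e2.trans (le_of_eq (by ring)))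
    have f3 := hmul ‖scatR b ζ‖ (δ⁻¹ * (M + M')) _ (by positivity) (norm_nonneg _) hr
      (e3.trans (mul_le_mul_of_nonneg_left (le_mul_of_one_le_right (by positivity) hL5)
        (norm_nonneg _)))
    have f4 := hmul ‖scatR b ζ‖ (δ⁻¹ * M * (|t| * Q)) _ (by positivity) (norm_nonneg _) hr
      (e4.trans (le_of_eq (by ring)))
    calc _ ≤ (‖r' * chi u δ ζ * G ζ‖ + ‖scatR b ζ * χ' * G ζ‖ + ‖scatR b ζ * chi u δ ζ * g'‖ +
        ‖scatR b ζ * chi u δ ζ * G ζ * (E ζ * (Complex.I * t) * q')‖) * L ^ 3 := by gcongr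
      _ ≤ C * (δ⁻¹ * M) + C * (2 * (Q * (δ ^ 2)⁻¹) * M) + C * (δ⁻¹ * (M + M')) +
          C * (δ⁻¹ * M * (|t| * Q)) := by
          rw [add_mul, add_mul, add_mul]; gcongr
      _ = K := by rw [hK]; ring
  have hwi := integrable_planeWeight
  have hFi : Integrable F := by
    have hFc : Continuous F := continuous_iff_continuousAt.2 fun ζ => (hFW ζ).continuousAt
    obtain ⟨C', hC'0, hC'⟩ := exists_scat_bound hb 3
    refine Integrable.mono' (hwi.const_mul (δ⁻¹ * M * C')) hFc.aestronglyMeasurable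
      (Eventually.of_forall fun ζ => ?_)
    calc ‖F ζ‖ ≤ (δ⁻¹ * M) * ‖scatR b ζ‖ := hFn ζ
      _ ≤ (δ⁻¹ * M) * (C' * planeWeight ζ) := by
          gcongr; exact norm_le_planeWeight_of_circWeight hC'0 (hC' ζ).1
      _ = _ := by ring
  have hδ2 : 0 ≤ (δ ^ 2)⁻¹ := by positivity
  obtain ⟨hai, ha0⟩ := integral_wirt_eq_zero hFW hFi (hwi.const_mul K)
    (fun ζ => hpoint ζ _ _ _ _ (hC ζ).2.1 ((norm_chiD_le u hδ ζ).trans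
      (by nlinarith [mul_nonneg (norm_nonneg (phaseD2 u ζ)) hδ2]))
      ((hGa ζ).trans (by linarith)) rfl)
    (fun ζ => hpoint ζ _ _ _ _ (hC ζ).2.2 (norm_chiDBar_le u hδ ζ)
      ((hGb ζ).trans (by linarith)) (RCLike.norm_conj _))
  obtain ⟨Cw, hCw0, hCw⟩ := exists_oscWeight_bound hb
  have hwG : Integrable fun ζ => oscWeight b z t ζ * G ζ := by
    refine Integrable.mono' (hwi.const_mul (Cw * M))
      ((measurable_oscWeight b z t).mul hGc.measurable).aestronglyMeasurable
      (Eventually.of_forall fun ζ => ?_)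
    rw [norm_mul]
    have h1 := hCw z t ζ
    have h2 := hGM ζ
    calc _ ≤ (Cw * planeWeight ζ) * M := by
          have := (planeWeight_pos ζ).le
          gcongr
      _ = _ := by ring
  refine ⟨fun ζ => oscWeight b z t ζ * G ζ - (Complex.I * t)⁻¹ * a ζ, ?_, fun ζ => ?_⟩
  · rw [integral_sub hwG (hai.const_mul _), integral_const_mul, ha0, mul_zero, sub_zero]
  · have hD : ((‖phaseD u ζ‖ ^ 2 + δ ^ 2 : ℝ) : ℂ) ≠ 0 := by
      have : (0:ℝ) < ‖phaseD u ζ‖ ^ 2 + δ ^ 2 := by positivity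
      exact_mod_cast this.ne'
    have hItne : Complex.I * (t : ℂ) ≠ 0 := mul_ne_zero Complex.I_ne_zero htc
    -- The defect of `χ` as a reciprocal, concentrated near the stationary points.
    have hqχ : 1 - chi u δ ζ * phaseD u ζ =
        (δ : ℂ) ^ 2 * ((‖phaseD u ζ‖ ^ 2 + δ ^ 2 : ℝ) : ℂ)⁻¹ := by
      have h1 : conj (phaseD u ζ) * phaseD u ζ = ((‖phaseD u ζ‖ ^ 2 : ℝ) : ℂ) := by
        rw [mul_comm, Complex.mul_conj, Complex.normSq_eq_norm_sq]
      rw [chi]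
      field_simp
      rw [h1]
      push_cast; ring
    have e : oscWeight b z t ζ * G ζ - (Complex.I * t)⁻¹ * a ζ =
        (scatR b ζ * ((δ : ℂ) ^ 2 * ((‖phaseD u ζ‖ ^ 2 + δ ^ 2 : ℝ) : ℂ)⁻¹) * G ζ -
          (Complex.I * t)⁻¹ * (scatRD b ζ * chi u δ ζ * G ζ + scatR b ζ * chiD u δ ζ * G ζ +
            scatR b ζ * chi u δ ζ * Ga ζ)) * E ζ := by
      rw [← hqχ]
      have : oscWeight b z t ζ = scatR b ζ * E ζ := rfl
      rw [this, ha]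
      field_simp
      ring
    beta_reduce
    rw [e, norm_mul, hEn, mul_one]
    refine (norm_sub_le _ _).trans (add_le_add ?_ ?_)
    · rw [norm_mul, norm_mul, norm_mul, norm_inv, Complex.norm_real, norm_pow, Complex.norm_real,
        Real.norm_of_nonneg hδ.le, Real.norm_of_nonneg (by positivity)]
      calc _ ≤ ‖scatR b ζ‖ * (δ ^ 2 * (‖phaseD u ζ‖ ^ 2 + δ ^ 2)⁻¹) * M := by
            gcongr; exact hGM ζ
        _ = _ := by ring
    · rw [norm_mul, norm_inv, hIt, mul_comm M |t|⁻¹, mul_assoc |t|⁻¹]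
      refine mul_le_mul_of_nonneg_left ?_ (by positivity)
      refine norm_add₃_le.trans ?_
      simp only [norm_mul, mul_add]
      refine add_le_add_three ?_ ?_ ?_
      · rw [mul_comm M]; gcongr; exact hGM ζ
      · rw [mul_comm M]; gcongr; exact hGM ζ
      · rw [mul_comm M]; gcongr; exact hGa ζ

lemma one_le_log_three_add {s : ℝ} (hs : 1 ≤ s) : 1 ≤ Real.log (3 + s) := by
  rw [Real.le_log_iff_exp_le (by linarith)]
  linarith [Real.exp_one_lt_d9]

/-- The oscillatory integral against a function with bounded `∂/∂ζ` derivative. -/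
lemma exists_oscillatory_bound {b : SchwartzMap ℂ ℂ} (hb : IsTransparentScatteringData b) :
    ∃ C : ℝ, 0 ≤ C ∧ ∀ (z : ℂ) (t : ℝ), 1 ≤ |t| → ∀ (G Ga Gb : ℂ → ℂ) (M M' : ℝ),
      (∀ ζ, HasWirt G (Ga ζ) (Gb ζ) ζ) → (∀ ζ, ‖G ζ‖ ≤ M) → (∀ ζ, ‖Ga ζ‖ ≤ M) →
      (∀ ζ, ‖Gb ζ‖ ≤ M') →
      ‖∫ ζ, oscWeight b z t ζ * G ζ‖ ≤ C * M * (Real.log (3 + |t|) / |t|) := by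
  -- Ten powers absorb the loss in `regularized_bounds`, three yield `planeWeight`.
  obtain ⟨C, hC0, hC⟩ := exists_scat_bound hb 13
  obtain ⟨J, hJ0, hJ⟩ := exists_integral_planeWeight_bound
  have hI0 : 0 ≤ ∫ ζ, planeWeight ζ := integral_nonneg fun ζ => (planeWeight_pos ζ).le
  refine ⟨80 * C * ((∫ ζ, planeWeight ζ) + 12 * J), by positivity,
    fun z t ht G Ga Gb M M' hG hGM hGa hGb => ?_⟩
  have htp : 0 < |t| := by linarith
  have ht0 : t ≠ 0 := abs_pos.1 htp
  have hM : 0 ≤ M := (norm_nonneg _).trans (hGM 0)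
  -- With this choice the defect term, of size `δ²`, matches the factor `|t|⁻¹` from the integration
  -- by parts.
  set δ : ℝ := (Real.sqrt |t|)⁻¹ with hδdef
  have hsq : 0 < Real.sqrt |t| := Real.sqrt_pos.2 htp
  have hδ : 0 < δ := inv_pos.2 hsq
  have hδ2 : δ ^ 2 = |t|⁻¹ := by rw [hδdef, inv_pow, Real.sq_sqrt htp.le]
  obtain ⟨P, hP, hPb⟩ := integral_oscWeight_eq hb (z := z) ht0 hδ hG hGM hGa hGb
  set u := z / (t : ℂ)
  obtain ⟨p, hp⟩ := exists_stationary_points u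
  set B : ℂ → ℝ := fun ζ => planeWeight ζ +
    ∑ i, planeWeight ζ * (‖ζ - p i‖ * (‖ζ - p i‖ + δ))⁻¹ with hB
  have hsumi : Integrable fun ζ => ∑ i, planeWeight ζ * (‖ζ - p i‖ * (‖ζ - p i‖ + δ))⁻¹ :=
    integrable_finsetSum _ fun i _ => (hJ (p i) δ hδ).1
  have hBi : Integrable B := integrable_planeWeight.add hsumi
  have hPB : ∀ᵐ ζ : ℂ, ‖P ζ‖ ≤ 80 * C * M * |t|⁻¹ * B ζ := by
    have hnull : (volume : Measure ℂ) (Set.range p) = 0 := (Set.finite_range p).measure_zero _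
    filter_upwards [compl_mem_ae_iff.2 hnull] with ζ hζ
    have hw := planeWeight_pos ζ
    have hBnn : 0 ≤ B ζ := by
      simp only [hB]
      exact add_nonneg hw.le (Finset.sum_nonneg fun i _ => by positivity)
    refine (hPb ζ).trans ?_
    by_cases hbad : ζ = 0 ∨ ‖ζ‖ = 1
    · obtain ⟨h1, h2, -⟩ := scat_eq_zero_of_bad b hbad
      rw [h1, h2]
      simp only [norm_zero, mul_zero, zero_mul, add_zero]
      positivity
    push Not at hbad
    obtain ⟨j, hv, hl, hl2⟩ := hp ζ hbad.1 hbad.2 hζ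
    obtain ⟨r1, r2, r3⟩ := regularized_bounds (norm_nonneg _) (one_le_circWeight ζ) hv hδ hl hl2
    rw [← norm_chi] at r2
    rw [← norm_chiD] at r3
    set L := circWeight ζ with hL
    have hL1 : 1 ≤ L := one_le_circWeight ζ
    set T := 1 + (‖ζ - p j‖ * (‖ζ - p j‖ + δ))⁻¹ with hT
    have hT0 : 0 ≤ T := by positivity
    have hTB : planeWeight ζ * T ≤ B ζ := by
      rw [hT, mul_add, mul_one]
      refine add_le_add le_rfl ?_
      exact Finset.single_le_sum (f := fun i => planeWeight ζ * (‖ζ - p i‖ * (‖ζ - p i‖ + δ))⁻¹)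
        (fun i _ => by positivity) (Finset.mem_univ j)
    have hterm : ∀ x y : ℝ, 0 ≤ x → x * L ^ 13 ≤ C → y ≤ 20 * L ^ 10 * T → x * y ≤ 20 * C * B ζ := by
      intro x y hx hxC hy
      have h3 : x * L ^ 10 ≤ C * planeWeight ζ := by
        apply norm_le_planeWeight_of_circWeight hC0
        calc _ = x * L ^ 13 := by rw [← hL]; ring
          _ ≤ C := hxC
      calc x * y ≤ x * (20 * L ^ 10 * T) := by gcongr
        _ = 20 * (x * L ^ 10) * T := by ring
        _ ≤ 20 * (C * planeWeight ζ) * T := by gcongr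
        _ = 20 * C * (planeWeight ζ * T) := by ring
        _ ≤ _ := by gcongr
    have k1 := hterm _ _ (norm_nonneg _) (hC ζ).1 r1
    have k2 := hterm _ _ (norm_nonneg _) (hC ζ).2.1 r2
    have k3 := hterm _ _ (norm_nonneg _) (hC ζ).1 r3
    have k4 := hterm _ _ (norm_nonneg _) (hC ζ).1 r2
    rw [hδ2] at k1 ⊢
    have hti : 0 ≤ |t|⁻¹ := by positivity
    calc _ = M * |t|⁻¹ * (‖scatR b ζ‖ * (‖phaseD u ζ‖ ^ 2 + |t|⁻¹)⁻¹ +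
          (‖scatRD b ζ‖ * ‖chi u δ ζ‖ + ‖scatR b ζ‖ * ‖chiD u δ ζ‖ +
          ‖scatR b ζ‖ * ‖chi u δ ζ‖)) := by ring
      _ ≤ M * |t|⁻¹ * (20 * C * B ζ + (20 * C * B ζ + 20 * C * B ζ + 20 * C * B ζ)) := by gcongr
      _ = _ := by ring
  have hlog1 := one_le_log_three_add ht
  have hlog : Real.log (1 + δ⁻¹) ≤ Real.log (3 + |t|) := by
    rw [hδdef, inv_inv]
    apply Real.log_le_log (by positivity)
    have : Real.sqrt |t| ≤ |t| := by
      rw [Real.sqrt_le_left htp.le]; nlinarith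
    linarith
  have hBint : ∫ ζ, B ζ ≤ ((∫ ζ, planeWeight ζ) + 12 * J) * Real.log (3 + |t|) := by
    rw [hB, integral_add integrable_planeWeight hsumi,
      integral_finsetSum _ fun i _ => (hJ (p i) δ hδ).1]
    have : ∑ i, ∫ ζ, planeWeight ζ * (‖ζ - p i‖ * (‖ζ - p i‖ + δ))⁻¹ ≤
        ∑ _i : Fin 6, J * (2 * Real.log (3 + |t|)) := by
      refine Finset.sum_le_sum fun i _ => (hJ (p i) δ hδ).2.trans ?_
      gcongr
      linarith
    simp only [Finset.sum_const, Finset.card_univ, Fintype.card_fin, nsmul_eq_mul] at this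
    push_cast at this
    nlinarith
  rw [hP]
  calc ‖∫ ζ, P ζ‖ ≤ ∫ ζ, 80 * C * M * |t|⁻¹ * B ζ :=
        norm_integral_le_of_norm_le (hBi.const_mul _) hPB
    _ = 80 * C * M * |t|⁻¹ * ∫ ζ, B ζ := integral_const_mul _ _
    _ ≤ 80 * C * M * |t|⁻¹ * (((∫ ζ, planeWeight ζ) + 12 * J) * Real.log (3 + |t|)) := by gcongr
    _ = _ := by rw [div_eq_mul_inv]; ring

/-! ### The regularised Cauchy kernel. -/

/-- The regularisation of `1 / x̄` at scale `κ`. -/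
noncomputable def regKernel (κ : ℝ) (x : ℂ) : ℂ := x * ((‖x‖ ^ 2 + κ ^ 2 : ℝ) : ℂ)⁻¹

/-- The coefficient of `dζ` in the differential of `regKernel κ`. -/
noncomputable def regKernelD (κ : ℝ) (x : ℂ) : ℂ := ((κ ^ 2 / (‖x‖ ^ 2 + κ ^ 2) ^ 2 : ℝ) : ℂ)

/-- The coefficient of `dζ̄` in the differential of `regKernel κ`. -/
noncomputable def regKernelDBar (κ : ℝ) (x : ℂ) : ℂ :=
  -(x ^ 2 / ((‖x‖ ^ 2 + κ ^ 2 : ℝ) : ℂ) ^ 2)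

/-- The two derivatives play different roles: the `∂/∂ζ` part is a positive kernel of mass bounded
independently of `κ`, a smoothed point mass, while the `∂/∂ζ̄` part is used only through a bound
that degenerates like `κ⁻²`. -/
lemma hasWirt_regKernel {κ : ℝ} (hκ : 0 < κ) (x : ℂ) :
    HasWirt (regKernel κ) (regKernelD κ x) (regKernelDBar κ x) x := by
  have hq := (hasDerivAt_id x).hasWirt
  have hne : ((‖x‖ ^ 2 + κ ^ 2 : ℝ) : ℂ) ≠ 0 := by
    have : (0:ℝ) < ‖x‖ ^ 2 + κ ^ 2 := by positivity
    exact_mod_cast this.ne'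
  have hD : HasWirt (fun x : ℂ => ((‖x‖ ^ 2 + κ ^ 2 : ℝ) : ℂ)) (conj x) x x := by
    refine (((hq.mul hq.conj).add (hasWirt_const ((κ : ℂ) ^ 2) x)).congr_coeff
      (by simp) (by simp)).congr_of_eventuallyEq (Eventually.of_forall fun y => ?_)
    simp only [id, Complex.mul_conj, Complex.normSq_eq_norm_sq]
    push_cast; ring
  have hinv := (hasDerivAt_inv hne).comp_hasWirt hD
  refine (hq.mul hinv).congr_coeff ?_ ?_
  · have h1 : x * conj x = ((‖x‖ ^ 2 : ℝ) : ℂ) := by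
      rw [Complex.mul_conj, Complex.normSq_eq_norm_sq]
    have h2 : ((κ ^ 2 / (‖x‖ ^ 2 + κ ^ 2) ^ 2 : ℝ) : ℂ) =
        (((‖x‖ ^ 2 + κ ^ 2 : ℝ) : ℂ) - ((‖x‖ ^ 2 : ℝ) : ℂ)) / ((‖x‖ ^ 2 + κ ^ 2 : ℝ) : ℂ) ^ 2 := by
      push_cast; ring
    rw [regKernelD, h2, ← h1]
    simp only [id]
    field_simp
    ring
  · simp only [regKernelDBar, id]
    field_simp
    ring

lemma norm_regKernel (κ : ℝ) (x : ℂ) : ‖regKernel κ x‖ = ‖x‖ / (‖x‖ ^ 2 + κ ^ 2) := by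
  rw [regKernel, norm_mul, norm_inv, Complex.norm_real, Real.norm_of_nonneg (by positivity)]
  rfl

lemma norm_regKernel_le_inv_norm (κ : ℝ) (x : ℂ) : ‖regKernel κ x‖ ≤ ‖x‖⁻¹ := by
  rw [norm_regKernel]
  rcases (norm_nonneg x).eq_or_lt with h | h
  · rw [← h]; simp
  · rw [inv_eq_one_div, div_le_div_iff₀ (by positivity) h]
    nlinarith [sq_nonneg κ]

lemma norm_regKernel_le {κ : ℝ} (hκ : 0 < κ) (x : ℂ) : ‖regKernel κ x‖ ≤ κ⁻¹ := by
  rw [norm_regKernel, inv_eq_one_div, div_le_div_iff₀ (by positivity) hκ]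
  nlinarith [sq_nonneg (‖x‖ - κ), sq_nonneg ‖x‖, sq_nonneg κ]

lemma norm_regKernelD {κ : ℝ} (x : ℂ) :
    ‖regKernelD κ x‖ = κ ^ 2 / (‖x‖ ^ 2 + κ ^ 2) ^ 2 := by
  rw [regKernelD, Complex.norm_real, Real.norm_of_nonneg (by positivity)]

lemma norm_regKernelD_le {κ : ℝ} (hκ : 0 < κ) (x : ℂ) : ‖regKernelD κ x‖ ≤ (κ ^ 2)⁻¹ := by
  rw [norm_regKernelD, inv_eq_one_div, div_le_div_iff₀ (by positivity) (by positivity)]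
  nlinarith [sq_nonneg (‖x‖ ^ 2), mul_nonneg (sq_nonneg ‖x‖) (sq_nonneg κ)]

lemma norm_regKernelDBar_le {κ : ℝ} (hκ : 0 < κ) (x : ℂ) :
    ‖regKernelDBar κ x‖ ≤ (κ ^ 2)⁻¹ := by
  rw [regKernelDBar, norm_neg, norm_div, norm_pow, norm_pow, Complex.norm_real,
    Real.norm_of_nonneg (by positivity), inv_eq_one_div,
    div_le_div_iff₀ (by positivity) (by positivity)]
  nlinarith [sq_nonneg (‖x‖ ^ 2), sq_nonneg (κ ^ 2), mul_nonneg (sq_nonneg ‖x‖) (sq_nonneg κ)]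

/-- The difference is exactly `κ² / (x̄ (|x|² + κ²))`. The right side is the kernel with logarithmic
integral, so the smoothing error is `κ` times a logarithm. -/
lemma norm_inv_sub_regKernel_le {κ : ℝ} (hκ : 0 < κ) (x : ℂ) :
    ‖(conj x)⁻¹ - regKernel κ x‖ ≤ 2 * κ * (‖x‖ * (‖x‖ + κ))⁻¹ := by
  by_cases hx : x = 0
  · simp [hx, regKernel]
  have hc : conj x ≠ 0 := by simpa using hx
  have hn : 0 < ‖x‖ := norm_pos_iff.2 hx
  have hne : ((‖x‖ ^ 2 + κ ^ 2 : ℝ) : ℂ) ≠ 0 := by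
    have : (0:ℝ) < ‖x‖ ^ 2 + κ ^ 2 := by positivity
    exact_mod_cast this.ne'
  have h1 : x * conj x = ((‖x‖ ^ 2 : ℝ) : ℂ) := by
    rw [Complex.mul_conj, Complex.normSq_eq_norm_sq]
  have e : (conj x)⁻¹ - regKernel κ x =
      ((κ ^ 2 : ℝ) : ℂ) * ((conj x)⁻¹ * ((‖x‖ ^ 2 + κ ^ 2 : ℝ) : ℂ)⁻¹) := by
    rw [regKernel]
    field_simp
    rw [mul_comm] at h1
    rw [h1]
    push_cast; ring
  rw [e, norm_mul, norm_mul, norm_inv, norm_inv, Complex.norm_real, Complex.norm_real,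
    RCLike.norm_conj, Real.norm_of_nonneg (by positivity), Real.norm_of_nonneg (by positivity),
    ← mul_inv, ← div_eq_mul_inv, ← div_eq_mul_inv, div_le_div_iff₀ (by positivity) (by positivity)]
  have : κ * (‖x‖ + κ) ≤ 2 * (‖x‖ ^ 2 + κ ^ 2) := by nlinarith [sq_nonneg (‖x‖ - κ)]
  have h3 := mul_le_mul_of_nonneg_left this (mul_nonneg hκ.le hn.le)
  nlinarith

/-! ### Bounds for the operators `A` and `B`. -/

lemma measurable_conj_comp {f : ℂ → ℂ} (hf : Measurable f) : Measurable fun x => conj (f x) :=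
  Complex.continuous_conj.measurable.comp hf

lemma integrable_weighted {w k : ℂ → ℂ} (hw : Measurable w) (hk : Measurable k) {g : ℂ → ℝ}
    {C M : ℝ} (hC : 0 ≤ C) (hb : ∀ ζ, ‖w ζ‖ ≤ C * planeWeight ζ) (hM : ∀ ζ, ‖k ζ‖ ≤ M * g ζ)
    (hg : Integrable fun ζ => planeWeight ζ * g ζ) :
    Integrable (fun ζ => w ζ * k ζ) ∧
      ‖∫ ζ, w ζ * k ζ‖ ≤ C * M * ∫ ζ, planeWeight ζ * g ζ := by
  have h : ∀ ζ, ‖w ζ * k ζ‖ ≤ C * M * (planeWeight ζ * g ζ) := by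
    intro ζ
    have := (planeWeight_pos ζ).le
    rw [norm_mul]
    calc _ ≤ (C * planeWeight ζ) * (M * g ζ) :=
          mul_le_mul (hb ζ) (hM ζ) (norm_nonneg _) (by positivity)
      _ = _ := by ring
  refine ⟨(hg.const_mul (C * M)).mono' (hw.mul hk).aestronglyMeasurable
    (Eventually.of_forall h), ?_⟩
  rw [← integral_const_mul]
  exact norm_integral_le_of_norm_le (hg.const_mul _) (Eventually.of_forall h)

lemma measurable_opA (b : SchwartzMap ℂ ℂ) (z : ℂ) (t : ℝ) {f : ℂ → ℂ} (hf : Measurable f) :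
    Measurable (opA b z t f) := by
  have hw := measurable_oscWeight b z t
  have hcf := measurable_conj_comp hf
  have : StronglyMeasurable fun l : ℂ => ∫ ζ : ℂ, oscWeight b z t ζ * conj (f ζ) / (ζ - l) := by
    refine StronglyMeasurable.integral_prod_right (f := fun l ζ : ℂ =>
      oscWeight b z t ζ * conj (f ζ) / (ζ - l)) ?_
    apply Measurable.stronglyMeasurable
    exact ((hw.comp measurable_snd).mul (hcf.comp measurable_snd)).div
      (measurable_snd.sub measurable_fst)
  exact this.measurable.const_mul _

lemma integrable_opB_integrand {b : SchwartzMap ℂ ℂ} (hb : IsTransparentScatteringData b)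
    (z : ℂ) (t : ℝ) {f : ℂ → ℂ} (hf : Measurable f) {M : ℝ} (hM : ∀ ζ, ‖f ζ‖ ≤ M) :
    Integrable fun ζ => oscWeight b z t ζ * conj (f ζ) := by
  obtain ⟨C, hC0, hC⟩ := exists_oscWeight_bound hb
  exact (integrable_weighted (g := fun _ => 1) (measurable_oscWeight b z t)
    (measurable_conj_comp hf) hC0 (hC z t) (M := M) (fun ζ => by simpa using hM ζ)
    (by simpa using integrable_planeWeight)).1

/-- No oscillation is used: the weight has modulus `|r|`, and the Cauchy kernel has a bounded
integral against `planeWeight`. Hence the constant is independent of `z` and `t`. -/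
lemma exists_opA_bound {b : SchwartzMap ℂ ℂ} (hb : IsTransparentScatteringData b) :
    ∃ C : ℝ, 0 ≤ C ∧ ∀ (z : ℂ) (t : ℝ) (f : ℂ → ℂ), Measurable f → ∀ M : ℝ, (∀ ζ, ‖f ζ‖ ≤ M) →
      ∀ l, Integrable (fun ζ => oscWeight b z t ζ * conj (f ζ) / (ζ - l)) ∧
        ‖opA b z t f l‖ ≤ C * M := by
  obtain ⟨C, hC0, hC⟩ := exists_oscWeight_bound hb
  obtain ⟨J, hJ0, hJ⟩ := exists_integral_planeWeight_div_bound
  refine ⟨1 / Real.pi * (C * J), by positivity, fun z t f hf M hM l => ?_⟩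
  have hM0 : 0 ≤ M := (norm_nonneg _).trans (hM 0)
  obtain ⟨h1, h2⟩ := integrable_weighted (g := fun ζ => ‖ζ - l‖⁻¹)
    (k := fun ζ => conj (f ζ) / (ζ - l)) (measurable_oscWeight b z t)
    ((measurable_conj_comp hf).div (by fun_prop)) hC0 (hC z t) (M := M) (fun ζ => by
      rw [norm_div, RCLike.norm_conj, div_eq_mul_inv]
      gcongr
      exact hM ζ) (hJ l).1
  simp only [← mul_div_assoc] at h1 h2
  refine ⟨h1, ?_⟩
  rw [opA, norm_mul, norm_neg, norm_div, norm_one, Complex.norm_real,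
    Real.norm_of_nonneg Real.pi_pos.le]
  calc _ ≤ 1 / Real.pi * (C * M * J) := by
        gcongr
        exact h2.trans (by gcongr; exact (hJ l).2)
    _ = _ := by ring

/-- The conjugate of `opA b z t f` is uniformly close to functions whose `∂/∂ζ` derivatives are
bounded uniformly in the scale of approximation. -/
lemma exists_regularization {b : SchwartzMap ℂ ℂ} (hb : IsTransparentScatteringData b) :
    ∃ C : ℝ, 0 ≤ C ∧ ∀ (z : ℂ) (t : ℝ) (f : ℂ → ℂ), Measurable f → ∀ M : ℝ, (∀ ζ, ‖f ζ‖ ≤ M) →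
      ∀ κ : ℝ, 0 < κ → ∃ (G Ga Gb : ℂ → ℂ) (M' : ℝ), (∀ ζ, HasWirt G (Ga ζ) (Gb ζ) ζ) ∧
        (∀ ζ, ‖G ζ‖ ≤ C * M) ∧ (∀ ζ, ‖Ga ζ‖ ≤ C * M) ∧ (∀ ζ, ‖Gb ζ‖ ≤ M') ∧
        ∀ ζ, ‖conj (opA b z t f ζ) - G ζ‖ ≤ C * M * (κ * (1 + Real.log (1 + κ⁻¹))) := by
  obtain ⟨C, hC0, hC⟩ := exists_oscWeight_bound hb
  obtain ⟨J1, hJ10, hJ1⟩ := exists_integral_planeWeight_div_bound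
  obtain ⟨J2, hJ20, hJ2⟩ := exists_integral_planeWeight_bound
  obtain ⟨J3, hJ30, hJ3⟩ := exists_integral_poisson_bound
  have hpi := Real.pi_pos
  refine ⟨1 / Real.pi * (C * (J1 + 2 * J2 + J3)), by positivity, fun z t f hf M hM κ hκ => ?_⟩
  have hM0 : 0 ≤ M := (norm_nonneg _).trans (hM 0)
  set ρ : ℂ → ℂ := fun η => conj (oscWeight b z t η) * f η with hρ
  have hρm : Measurable ρ := (measurable_conj_comp (measurable_oscWeight b z t)).mul hf
  have hρb : ∀ η, ‖ρ η‖ ≤ (C * M) * planeWeight η := by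
    intro η
    simp only [hρ, norm_mul, RCLike.norm_conj]
    have h1 := hC z t η
    have h2 := hM η
    have := (planeWeight_pos η).le
    calc _ ≤ (C * planeWeight η) * M := by gcongr
      _ = _ := by ring
  have hCM : 0 ≤ C * M := by positivity
  have hKc : Continuous (regKernel κ) :=
    continuous_iff_continuousAt.2 fun x => (hasWirt_regKernel hκ x).continuousAt
  have hKDm : Measurable (regKernelD κ) := by unfold regKernelD; fun_prop
  have hKDBm : Measurable (regKernelDBar κ) := by unfold regKernelDBar; fun_prop
  have hc : ‖-(1 / (Real.pi : ℂ))‖ = 1 / Real.pi := by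
    rw [norm_neg, norm_div, norm_one, Complex.norm_real, Real.norm_of_nonneg hpi.le]
  have iK : ∀ ζ, Integrable (fun η => ρ η * regKernel κ (η - ζ)) ∧
      ‖∫ η, ρ η * regKernel κ (η - ζ)‖ ≤ C * M * 1 * ∫ η, planeWeight η * ‖η - ζ‖⁻¹ := fun ζ =>
    integrable_weighted (g := fun η => ‖η - ζ‖⁻¹) (k := fun η => regKernel κ (η - ζ)) hρm
      (hKc.measurable.comp (measurable_id.sub_const ζ)) hCM hρb (M := 1)
      (fun η => by rw [one_mul]; exact norm_regKernel_le_inv_norm κ (η - ζ)) (hJ1 ζ).1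
  have iD : ∀ ζ, Integrable (fun η => ρ η * -regKernelD κ (η - ζ)) ∧
      ‖∫ η, ρ η * -regKernelD κ (η - ζ)‖ ≤
        C * M * 1 * ∫ η, planeWeight η * (κ ^ 2 / (‖η - ζ‖ ^ 2 + κ ^ 2) ^ 2) := by
    intro ζ
    refine integrable_weighted (g := fun η => κ ^ 2 / (‖η - ζ‖ ^ 2 + κ ^ 2) ^ 2)
      (k := fun η => -regKernelD κ (η - ζ)) hρm
      (hKDm.comp (measurable_id.sub_const ζ)).neg hCM hρb (M := 1)
      (fun η => by rw [one_mul, norm_neg]; exact (norm_regKernelD (η - ζ)).le) ?_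
    refine (hJ3 ζ κ hκ).1.mono' (measurable_planeWeight.mul (by fun_prop)).aestronglyMeasurable
      (Eventually.of_forall fun η => ?_)
    have := (planeWeight_pos η).le
    rw [Real.norm_of_nonneg (by positivity)]
    exact mul_le_of_le_one_left (by positivity) (planeWeight_le_one η)
  have iDB : ∀ ζ, Integrable (fun η => ρ η * -regKernelDBar κ (η - ζ)) ∧
      ‖∫ η, ρ η * -regKernelDBar κ (η - ζ)‖ ≤ C * M * (κ ^ 2)⁻¹ * ∫ η, planeWeight η * 1 := fun ζ =>
    integrable_weighted (g := fun _ => 1) (k := fun η => -regKernelDBar κ (η - ζ)) hρm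
      (hKDBm.comp (measurable_id.sub_const ζ)).neg hCM hρb (M := (κ ^ 2)⁻¹)
      (fun η => by rw [norm_neg, mul_one]; exact norm_regKernelDBar_le hκ (η - ζ))
      (by simpa using integrable_planeWeight)
  have hint : ∀ ζ, HasWirt (fun x => ∫ η, ρ η * regKernel κ (η - x))
      (∫ η, ρ η * -regKernelD κ (η - ζ)) (∫ η, ρ η * -regKernelDBar κ (η - ζ)) ζ := by
    intro ζ
    have hdiff : ∀ η x : ℂ, HasWirt (fun x => ρ η * regKernel κ (η - x))
        (ρ η * -regKernelD κ (η - x)) (ρ η * -regKernelDBar κ (η - x)) x := by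
      intro η x
      have h1 : HasWirt (fun y : ℂ => η - y) (-1) 0 x := ((hasDerivAt_id x).const_sub η).hasWirt
      have h2 : HasFDerivAt (fun y => regKernel κ (η - y)) _ x :=
        HasFDerivAt.comp x (hasWirt_regKernel hκ (η - x)) h1
      have h3 : HasWirt (fun y => regKernel κ (η - y)) (-regKernelD κ (η - x))
          (-regKernelDBar κ (η - x)) x := by
        refine HasFDerivAt.congr_fderiv h2 ?_
        ext v
        simp
      exact ((hasWirt_const (ρ η) x).mul h3).congr_coeff (by simp) (by simp)
    have hm1 : AEStronglyMeasurable (fun η => wirtCLM (ρ η * -regKernelD κ (η - ζ))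
        (ρ η * -regKernelDBar κ (η - ζ))) volume := by
      unfold wirtCLM
      exact ((iD ζ).1.aestronglyMeasurable.smul_const _).add
        ((iDB ζ).1.aestronglyMeasurable.smul_const _)
    have hbound : ∀ η x, ‖wirtCLM (ρ η * -regKernelD κ (η - x))
        (ρ η * -regKernelDBar κ (η - x))‖ ≤ C * M * (2 * (κ ^ 2)⁻¹) * planeWeight η := by
      intro η x
      refine (norm_wirtCLM_le _ _).trans ?_
      rw [norm_mul (ρ η), norm_mul (ρ η), norm_neg, norm_neg]
      have h1 := norm_regKernelD_le hκ (η - x)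
      have h2 := norm_regKernelDBar_le hκ (η - x)
      have h3 := hρb η
      have := (planeWeight_pos η).le
      calc _ ≤ (C * M * planeWeight η) * (κ ^ 2)⁻¹ + (C * M * planeWeight η) * (κ ^ 2)⁻¹ := by
            gcongr
        _ = _ := by ring
    have := hasFDerivAt_integral_of_dominated_of_fderiv_le (𝕜 := ℝ) (μ := volume)
      (F := fun x η => ρ η * regKernel κ (η - x))
      (F' := fun x η => wirtCLM (ρ η * -regKernelD κ (η - x)) (ρ η * -regKernelDBar κ (η - x)))
      (bound := fun η => C * M * (2 * (κ ^ 2)⁻¹) * planeWeight η) (x₀ := ζ) (s := Set.univ)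
      Filter.univ_mem (Eventually.of_forall fun x => (iK x).1.aestronglyMeasurable) (iK ζ).1 hm1
      (Eventually.of_forall fun η x _ => hbound η x) (integrable_planeWeight.const_mul _)
      (Eventually.of_forall fun η x _ => hdiff η x)
    refine HasFDerivAt.congr_fderiv this ?_
    have hi : Integrable (fun η => wirtCLM (ρ η * -regKernelD κ (η - ζ))
        (ρ η * -regKernelDBar κ (η - ζ))) :=
      (integrable_planeWeight.const_mul (C * M * (2 * (κ ^ 2)⁻¹))).mono' hm1
        (Eventually.of_forall fun η => hbound η ζ)
    ext v
    rw [ContinuousLinearMap.integral_apply hi]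
    simp only [wirtCLM_apply]
    rw [integral_add ((iD ζ).1.mul_const _) ((iDB ζ).1.mul_const _), integral_mul_const,
      integral_mul_const]
  have hsplit : ∀ X Y : ℝ, X ≤ C * M * Y → Y ≤ J1 + 2 * J2 + J3 →
      1 / Real.pi * X ≤ 1 / Real.pi * (C * (J1 + 2 * J2 + J3)) * M := by
    intro X Y h1 h2
    calc 1 / Real.pi * X ≤ 1 / Real.pi * (C * M * (J1 + 2 * J2 + J3)) := by
          gcongr; exact h1.trans (by gcongr)
      _ = _ := by ring
  refine ⟨fun ζ => -(1 / (Real.pi : ℂ)) * ∫ η, ρ η * regKernel κ (η - ζ),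
    fun ζ => -(1 / (Real.pi : ℂ)) * ∫ η, ρ η * -regKernelD κ (η - ζ),
    fun ζ => -(1 / (Real.pi : ℂ)) * ∫ η, ρ η * -regKernelDBar κ (η - ζ),
    1 / Real.pi * (C * M * (κ ^ 2)⁻¹ * ∫ η, planeWeight η * 1),
    fun ζ => ?_, fun ζ => ?_, fun ζ => ?_, fun ζ => ?_, fun ζ => ?_⟩
  · exact ((hasWirt_const _ ζ).mul (hint ζ)).congr_coeff (by simp) (by simp)
  · rw [norm_mul, hc]
    exact hsplit _ _ ((iK ζ).2.trans (le_of_eq (by rw [mul_one]))) ((hJ1 ζ).2.trans (by linarith))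
  · rw [norm_mul, hc]
    -- Uniform in `κ`: `ρ` is bounded and the smoothed point mass has bounded total mass.
    refine hsplit _ (∫ η, κ ^ 2 / (‖η - ζ‖ ^ 2 + κ ^ 2) ^ 2) ((iD ζ).2.trans ?_)
      ((hJ3 ζ κ hκ).2.trans (by linarith))
    rw [mul_one]
    refine mul_le_mul_of_nonneg_left ?_ hCM
    refine integral_mono_of_nonneg (Eventually.of_forall fun η => ?_) (hJ3 ζ κ hκ).1
      (Eventually.of_forall fun η => ?_)
    · exact mul_nonneg (planeWeight_pos η).le (by positivity)
    · exact mul_le_of_le_one_left (by positivity) (planeWeight_le_one η)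
  · rw [norm_mul, hc]
    gcongr
    exact (iDB ζ).2
  · obtain ⟨hi1, hi2⟩ := integrable_weighted (g := fun η => (‖η - ζ‖ * (‖η - ζ‖ + κ))⁻¹)
      (k := fun η => (conj (η - ζ))⁻¹ - regKernel κ (η - ζ)) hρm
      ((measurable_conj_comp (measurable_id.sub_const ζ)).inv.sub
        (hKc.measurable.comp (measurable_id.sub_const ζ))) hCM hρb (M := 2 * κ)
      (fun η => norm_inv_sub_regKernel_le hκ (η - ζ)) (hJ2 ζ κ hκ).1
    have e : conj (opA b z t f ζ) - -(1 / (Real.pi : ℂ)) * ∫ η, ρ η * regKernel κ (η - ζ) =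
        -(1 / (Real.pi : ℂ)) * ∫ η, ρ η * ((conj (η - ζ))⁻¹ - regKernel κ (η - ζ)) := by
      have e1 : conj (opA b z t f ζ) = -(1 / (Real.pi : ℂ)) * ∫ η, ρ η * (conj (η - ζ))⁻¹ := by
        rw [opA, map_mul, ← integral_conj]
        congr 1
        · simp
        · refine integral_congr_ae (Eventually.of_forall fun η => ?_)
          simp only [hρ, map_div₀, map_mul, Complex.conj_conj]
          ring
      have i1 : Integrable fun η => ρ η * (conj (η - ζ))⁻¹ := by
        refine (hi1.add (iK ζ).1).congr (Eventually.of_forall fun η => ?_)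
        simp only [Pi.add_apply]
        ring
      simp only [mul_sub]
      rw [e1, integral_sub i1 (iK ζ).1]
      ring
    rw [e, norm_mul, hc]
    have hlog : 0 ≤ 1 + Real.log (1 + κ⁻¹) :=
      add_nonneg zero_le_one (Real.log_nonneg (by linarith [inv_pos.2 hκ]))
    calc _ ≤ 1 / Real.pi * (C * M * (2 * κ) * (J2 * (1 + Real.log (1 + κ⁻¹)))) := by
          gcongr
          exact hi2.trans (by gcongr; exact (hJ2 ζ κ hκ).2)
      _ = 1 / Real.pi * (C * (2 * J2)) * M * (κ * (1 + Real.log (1 + κ⁻¹))) := by ring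
      _ ≤ _ := by
          gcongr
          linarith

/-- The regularised amplitude has bounds independent of `κ`, so the stationary phase estimate
applies at no cost and `κ = |t|⁻¹` brings the smoothing error down to the same size. -/
lemma exists_opB_opA_bound {b : SchwartzMap ℂ ℂ} (hb : IsTransparentScatteringData b) :
    ∃ C : ℝ, 0 ≤ C ∧ ∀ (z : ℂ) (t : ℝ), 1 ≤ |t| → ∀ f : ℂ → ℂ, Measurable f → ∀ M : ℝ,
      (∀ ζ, ‖f ζ‖ ≤ M) → ‖opB b z t (opA b z t f)‖ ≤ C * M * (Real.log (3 + |t|) / |t|) := by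
  obtain ⟨Cw, hCw0, hCw⟩ := exists_oscWeight_bound hb
  obtain ⟨Cr, hCr0, hCr⟩ := exists_regularization hb
  obtain ⟨Co, hCo0, hCo⟩ := exists_oscillatory_bound hb
  have hI0 : 0 ≤ ∫ ζ, planeWeight ζ := integral_nonneg fun ζ => (planeWeight_pos ζ).le
  refine ⟨Co * Cr + Cw * Cr * 2 * ∫ ζ, planeWeight ζ, by positivity,
    fun z t ht f hf M hM => ?_⟩
  have hM0 : 0 ≤ M := (norm_nonneg _).trans (hM 0)
  have htp : 0 < |t| := by linarith
  obtain ⟨G, Ga, Gb, M', hG, hGM, hGa, hGb, hd⟩ := hCr z t f hf M hM |t|⁻¹ (inv_pos.2 htp)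
  have hGm : Measurable G :=
    (continuous_iff_continuousAt.2 fun ζ => (hG ζ).continuousAt).measurable
  have hw := measurable_oscWeight b z t
  have hA := measurable_opA b z t hf
  have h1 := hCo z t ht G Ga Gb _ M' hG hGM hGa hGb
  have iG := integrable_weighted (g := fun _ => 1) hw hGm hCw0 (hCw z t)
    (M := Cr * M) (fun ζ => by simpa using hGM ζ) (by simpa using integrable_planeWeight)
  have iR := integrable_weighted (g := fun _ => 1) (k := fun ζ => conj (opA b z t f ζ) - G ζ) hw
    ((measurable_conj_comp hA).sub hGm) hCw0 (hCw z t)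
    (fun ζ => (hd ζ).trans (le_of_eq (mul_one _).symm)) (by simpa using integrable_planeWeight)
  have e : opB b z t (opA b z t f) = (∫ ζ, oscWeight b z t ζ * G ζ) +
      ∫ ζ, oscWeight b z t ζ * (conj (opA b z t f ζ) - G ζ) := by
    rw [opB, ← integral_add iG.1 iR.1]
    refine integral_congr_ae (Eventually.of_forall fun ζ => ?_)
    simp only []
    ring
  have hlog1 := one_le_log_three_add ht
  have hlog : 1 + Real.log (1 + |t|) ≤ 2 * Real.log (3 + |t|) := by
    have : Real.log (1 + |t|) ≤ Real.log (3 + |t|) := Real.log_le_log (by linarith) (by linarith)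
    linarith
  have h2 := iR.2
  simp only [mul_one, inv_inv] at h2
  rw [e]
  refine (norm_add_le _ _).trans ?_
  calc _ ≤ Co * (Cr * M) * (Real.log (3 + |t|) / |t|) +
        Cw * (Cr * M * (|t|⁻¹ * (2 * Real.log (3 + |t|)))) * ∫ ζ, planeWeight ζ := by
        refine add_le_add h1 (h2.trans ?_)
        gcongr
    _ = _ := by rw [div_eq_mul_inv]; ring

lemma log_three_add_le {s : ℝ} (hs : 1 ≤ s) :
    Real.log (3 + s) / s ^ ((1 : ℝ) / 4) ≤ 32 / s ^ ((1 : ℝ) / 14) := by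
  have hs0 : 0 < s := by linarith
  have h1 : Real.log (3 + s) ≤ (4 * s) ^ ((1 : ℝ) / 8) / (1 / 8) :=
    (Real.log_le_log (by linarith) (by linarith)).trans
      (Real.log_le_rpow_div (by linarith) (by norm_num))
  have h4 : (4 : ℝ) ^ ((1 : ℝ) / 8) ≤ 4 := by
    calc (4 : ℝ) ^ ((1 : ℝ) / 8) ≤ 4 ^ (1 : ℝ) :=
          Real.rpow_le_rpow_of_exponent_le (by norm_num) (by norm_num)
      _ = 4 := Real.rpow_one 4
  rw [Real.mul_rpow (by norm_num) hs0.le] at h1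
  have hp : 0 < s ^ ((1 : ℝ) / 8) := Real.rpow_pos_of_pos hs0 _
  have h2 : Real.log (3 + s) ≤ 32 * s ^ ((1 : ℝ) / 8) := by
    refine h1.trans ?_
    rw [div_le_iff₀ (by norm_num)]
    nlinarith
  -- It remains to compare exponents: `1/8 + 1/14 ≤ 1/4`.
  rw [div_le_div_iff₀ (Real.rpow_pos_of_pos hs0 _) (Real.rpow_pos_of_pos hs0 _)]
  calc _ ≤ 32 * s ^ ((1 : ℝ) / 8) * s ^ ((1 : ℝ) / 14) := by
        gcongr
    _ = 32 * s ^ ((1 : ℝ) / 8 + 1 / 14) := by rw [mul_assoc, ← Real.rpow_add hs0]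
    _ ≤ _ := by
        gcongr
        norm_num

lemma exists_opA_opA_bound {b : SchwartzMap ℂ ℂ} (hb : IsTransparentScatteringData b) :
    ∃ C : ℝ, 0 ≤ C ∧ ∀ (z : ℂ) (t : ℝ), 1 ≤ |t| → ∀ f : ℂ → ℂ, Measurable f → ∀ M : ℝ,
      (∀ ζ, ‖f ζ‖ ≤ M) → ∀ l, ‖opA b z t (opA b z t f) l‖ ≤ C / |t| ^ ((1 : ℝ) / 14) * M := by
  obtain ⟨Cw, hCw0, hCw⟩ := exists_oscWeight_bound hb
  obtain ⟨Cr, hCr0, hCr⟩ := exists_regularization hb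
  obtain ⟨Co, hCo0, hCo⟩ := exists_oscillatory_bound hb
  obtain ⟨J1, hJ10, hJ1⟩ := exists_integral_planeWeight_div_bound
  obtain ⟨J2, hJ20, hJ2⟩ := exists_integral_planeWeight_bound
  have hpi := Real.pi_pos
  refine ⟨1 / Real.pi * (Cw * Cr * 2 * J1 + Cw * Cr * 4 * J2 + Co * (2 * Cr)) * 32, by positivity,
    fun z t ht f hf M hM l => ?_⟩
  have hM0 : 0 ≤ M := (norm_nonneg _).trans (hM 0)
  have htp : 0 < |t| := by linarith
  -- The smoothing scale for both kernels is `κ = s⁻¹ = |t|^(-1/4)`.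
  set s : ℝ := |t| ^ ((1 : ℝ) / 4) with hs
  have hs0 : 0 < s := Real.rpow_pos_of_pos htp _
  have hs1 : 1 ≤ s := Real.one_le_rpow ht (by norm_num)
  have hs4 : s ^ 4 = |t| := by
    rw [hs, ← Real.rpow_natCast, ← Real.rpow_mul htp.le]; norm_num
  have hst : s ≤ |t| := by rw [← hs4]; exact le_self_pow₀ hs1 (by norm_num)
  have hκ : 0 < s⁻¹ := inv_pos.2 hs0
  obtain ⟨G, Ga, Gb, M', hG, hGM, hGa, hGb, hd⟩ := hCr z t f hf M hM s⁻¹ hκ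
  have hM'0 : 0 ≤ M' := (norm_nonneg _).trans (hGb 0)
  have hGm : Measurable G :=
    (continuous_iff_continuousAt.2 fun ζ => (hG ζ).continuousAt).measurable
  have hw := measurable_oscWeight b z t
  have hA := measurable_opA b z t hf
  have hKc : Continuous (regKernel s⁻¹) :=
    continuous_iff_continuousAt.2 fun x => (hasWirt_regKernel hκ x).continuousAt
  set H : ℂ → ℂ := fun ζ => conj (regKernel s⁻¹ (ζ - l)) with hH
  have hHm : Measurable H := measurable_conj_comp (hKc.measurable.comp (measurable_id.sub_const l))
  have hHn : ∀ ζ, ‖H ζ‖ ≤ s := by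
    intro ζ
    simp only [hH, RCLike.norm_conj]
    exact (norm_regKernel_le hκ _).trans (le_of_eq (inv_inv s))
  have hHW : ∀ ζ, HasWirt H (conj (regKernelDBar s⁻¹ (ζ - l))) (conj (regKernelD s⁻¹ (ζ - l))) ζ := by
    intro ζ
    have h1 : HasWirt (fun y : ℂ => y - l) 1 0 ζ := ((hasDerivAt_id ζ).sub_const l).hasWirt
    have h2 : HasFDerivAt (fun y => regKernel s⁻¹ (y - l)) _ ζ :=
      HasFDerivAt.comp (f := fun y : ℂ => y - l) ζ (hasWirt_regKernel hκ (ζ - l)) h1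
    have h3 : HasWirt (fun y => regKernel s⁻¹ (y - l)) (regKernelD s⁻¹ (ζ - l))
        (regKernelDBar s⁻¹ (ζ - l)) ζ := by
      refine HasFDerivAt.congr_fderiv h2 ?_
      ext v
      simp
    exact h3.conj
  have hk2 : ((s⁻¹) ^ 2)⁻¹ = s ^ 2 := by rw [inv_pow, inv_inv]
  have hs2 : s ≤ s ^ 2 := le_self_pow₀ hs1 (by norm_num)
  have hCrM : 0 ≤ Cr * M := by positivity
  -- Conjugation exchanges the two derivatives, so `∂H/∂ζ` is the unfavourable one, bounded only by
  -- `κ⁻² = s²`. This is where the rate drops below `log |t| / |t|`.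
  have hmain := hCo z t ht (fun ζ => G ζ * H ζ) _ _ (2 * Cr * M * s ^ 2) ((M' + Cr * M) * s ^ 2)
    (fun ζ => (hG ζ).mul (hHW ζ))
    (fun ζ => by
      rw [norm_mul]
      calc _ ≤ (Cr * M) * s ^ 2 := mul_le_mul (hGM ζ) ((hHn ζ).trans hs2) (norm_nonneg _) hCrM
        _ ≤ _ := by nlinarith [mul_nonneg hCrM (sq_nonneg s)])
    (fun ζ => by
      refine (norm_add_le _ _).trans ?_
      rw [norm_mul, norm_mul]
      have h1 := norm_regKernelDBar_le hκ (ζ - l)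
      rw [hk2, ← RCLike.norm_conj] at h1
      have h2 := (hHn ζ).trans hs2
      calc _ ≤ (Cr * M) * s ^ 2 + (Cr * M) * s ^ 2 :=
            add_le_add (mul_le_mul (hGa ζ) h2 (norm_nonneg _) hCrM)
              (mul_le_mul (hGM ζ) h1 (norm_nonneg _) hCrM)
        _ = _ := by ring)
    (fun ζ => by
      refine (norm_add_le _ _).trans ?_
      rw [norm_mul, norm_mul]
      have h1 := norm_regKernelD_le hκ (ζ - l)
      rw [hk2, ← RCLike.norm_conj] at h1
      have h2 := (hHn ζ).trans hs2
      calc _ ≤ M' * s ^ 2 + (Cr * M) * s ^ 2 :=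
            add_le_add (mul_le_mul (hGb ζ) h2 (norm_nonneg _) hM'0)
              (mul_le_mul (hGM ζ) h1 (norm_nonneg _) hCrM)
        _ = _ := by ring)
  have iGH := integrable_weighted (g := fun _ => 1) (k := fun ζ => G ζ * H ζ) hw (hGm.mul hHm) hCw0
    (hCw z t) (M := Cr * M * s) (fun ζ => by
      rw [norm_mul, mul_one]
      exact mul_le_mul (hGM ζ) (hHn ζ) (norm_nonneg _) hCrM)
    (by simpa using integrable_planeWeight)
  have iR := integrable_weighted (g := fun ζ => ‖ζ - l‖⁻¹)
    (k := fun ζ => (conj (opA b z t f ζ) - G ζ) * (ζ - l)⁻¹) hw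
    (((measurable_conj_comp hA).sub hGm).mul (measurable_id.sub_const l).inv) hCw0 (hCw z t)
    (fun ζ => by
      rw [norm_mul, norm_inv]
      exact mul_le_mul_of_nonneg_right (hd ζ) (by positivity)) (hJ1 l).1
  have iS := integrable_weighted (g := fun ζ => (‖ζ - l‖ * (‖ζ - l‖ + s⁻¹))⁻¹)
    (k := fun ζ => G ζ * ((ζ - l)⁻¹ - H ζ)) hw
    (hGm.mul ((measurable_id.sub_const l).inv.sub hHm)) hCw0 (hCw z t)
    (M := Cr * M * (2 * s⁻¹)) (fun ζ => by
      have h1 := norm_inv_sub_regKernel_le hκ (ζ - l)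
      have h2 : ‖(ζ - l)⁻¹ - H ζ‖ = ‖(conj (ζ - l))⁻¹ - regKernel s⁻¹ (ζ - l)‖ := by
        rw [← RCLike.norm_conj]
        simp only [hH, map_sub, map_inv₀, Complex.conj_conj]
      rw [norm_mul, h2, mul_assoc]
      exact mul_le_mul (hGM ζ) h1 (norm_nonneg _) hCrM) (hJ2 l s⁻¹ hκ).1
  -- Error from smoothing `conj (A f)`, error from smoothing the outer kernel, and the smooth
  -- oscillatory integral.
  have e : ∫ ζ : ℂ, oscWeight b z t ζ * conj (opA b z t f ζ) / (ζ - l) =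
      (∫ ζ, oscWeight b z t ζ * ((conj (opA b z t f ζ) - G ζ) * (ζ - l)⁻¹)) +
      (∫ ζ, oscWeight b z t ζ * (G ζ * ((ζ - l)⁻¹ - H ζ))) +
      ∫ ζ, oscWeight b z t ζ * (G ζ * H ζ) := by
    have hadd := integral_add (iR.1.add iS.1) iGH.1
    simp only [Pi.add_apply] at hadd
    rw [← integral_add iR.1 iS.1, ← hadd]
    refine integral_congr_ae (Eventually.of_forall fun ζ => ?_)
    simp only []
    ring
  have hlog1 := one_le_log_three_add ht
  have hlog : 1 + Real.log (1 + s) ≤ 2 * Real.log (3 + |t|) := by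
    have : Real.log (1 + s) ≤ Real.log (3 + |t|) := Real.log_le_log (by linarith) (by linarith)
    linarith
  have hlog0 : 0 ≤ 1 + Real.log (1 + s) := add_nonneg zero_le_one (Real.log_nonneg (by linarith))
  have h2 := iR.2
  have h3 := iS.2
  have hj := (hJ2 l s⁻¹ hκ).2
  simp only [inv_inv] at h2 h3 hj
  -- Since `|t| = s⁴`, the oscillatory term is of order `s⁻² log |t|`, smaller than the two errors'
  -- bound `s⁻¹ log |t|`.
  have hts : Real.log (3 + |t|) / |t| * s ^ 2 ≤ s⁻¹ * Real.log (3 + |t|) := by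
    rw [div_mul_eq_mul_div, div_le_iff₀ htp, ← hs4]
    have h5 : s⁻¹ * Real.log (3 + s ^ 4) * s ^ 4 = Real.log (3 + s ^ 4) * s ^ 3 := by
      field_simp
    rw [h5]
    rw [← hs4] at hlog1
    gcongr
    norm_num
  rw [opA, e, norm_mul, norm_neg, norm_div, norm_one, Complex.norm_real,
    Real.norm_of_nonneg hpi.le]
  calc _ ≤ 1 / Real.pi * (Cw * (Cr * M * (s⁻¹ * (2 * Real.log (3 + |t|)))) * J1 +
        Cw * (Cr * M * (2 * s⁻¹)) * (J2 * (2 * Real.log (3 + |t|))) +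
        Co * (2 * Cr * M) * (s⁻¹ * Real.log (3 + |t|))) := by
        gcongr
        refine norm_add₃_le.trans (add_le_add_three ?_ ?_ ?_)
        · exact h2.trans (mul_le_mul (by gcongr) (hJ1 l).2 (integral_nonneg fun ζ =>
            mul_nonneg (planeWeight_pos ζ).le (by positivity)) (by positivity))
        · refine h3.trans ?_
          gcongr
          exact hj.trans (by gcongr)
        · refine hmain.trans ?_
          calc _ = Co * (2 * Cr * M) * (Real.log (3 + |t|) / |t| * s ^ 2) := by ring
            _ ≤ _ := by gcongr
    _ = 1 / Real.pi * (Cw * Cr * 2 * J1 + Cw * Cr * 4 * J2 + Co * (2 * Cr)) * M *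
        (Real.log (3 + |t|) / s) := by rw [div_eq_mul_inv (Real.log _)]; ring
    _ ≤ 1 / Real.pi * (Cw * Cr * 2 * J1 + Cw * Cr * 4 * J2 + Co * (2 * Cr)) * M *
        (32 / |t| ^ ((1 : ℝ) / 14)) := by
        exact mul_le_mul_of_nonneg_left (log_three_add_le ht) (by positivity)
    _ = _ := by ring

/-! ### Iterates of `A` and assembly of the estimates. -/

lemma measurable_bounded_iterate {b : SchwartzMap ℂ ℂ} (hb : IsTransparentScatteringData b)
    (z : ℂ) (t : ℝ) {f : ℂ → ℂ} (hf : Measurable f) {M : ℝ} (hM : ∀ ζ, ‖f ζ‖ ≤ M) (n : ℕ) :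
    Measurable ((opA b z t)^[n] f) ∧ ∃ M' : ℝ, ∀ ζ, ‖(opA b z t)^[n] f ζ‖ ≤ M' := by
  obtain ⟨C, -, hC⟩ := exists_opA_bound hb
  induction n with
  | zero => exact ⟨by simpa using hf, M, by simpa using hM⟩
  | succ n ih =>
    obtain ⟨h1, M', h2⟩ := ih
    rw [Function.iterate_succ_apply']
    exact ⟨measurable_opA b z t h1, C * M', fun ζ => (hC z t _ h1 M' h2 ζ).2⟩

lemma norm_iterate_even_le {b : SchwartzMap ℂ ℂ} (hb : IsTransparentScatteringData b)
    {z : ℂ} {t q : ℝ} (h : ∀ f : ℂ → ℂ, Measurable f → ∀ M : ℝ, (∀ ζ, ‖f ζ‖ ≤ M) →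
      ∀ l, ‖opA b z t (opA b z t f) l‖ ≤ q * M) {f : ℂ → ℂ} (hf : Measurable f) {M : ℝ}
    (hM : ∀ ζ, ‖f ζ‖ ≤ M) (k : ℕ) (ζ : ℂ) : ‖(opA b z t)^[2 * k] f ζ‖ ≤ q ^ k * M := by
  induction k generalizing ζ with
  | zero => simpa using hM ζ
  | succ k ih =>
    have e : 2 * (k + 1) = 2 * k + 1 + 1 := by ring
    rw [e, Function.iterate_succ_apply', Function.iterate_succ_apply', pow_succ', mul_assoc]
    exact h _ (measurable_bounded_iterate hb z t hf hM _).1 _ ih ζ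

lemma log_three_add_le_two_mul_log {s : ℝ} (hs : 3 ≤ s) : Real.log (3 + s) ≤ 2 * Real.log s := by
  have : 2 * Real.log s = Real.log (s ^ 2) := by rw [Real.log_pow]; norm_num
  rw [this]
  exact Real.log_le_log (by linarith) (by nlinarith)

theorem lemma3 (b : SchwartzMap ℂ ℂ) (hb : IsTransparentScatteringData b) :
    -- all the integrals involved converge absolutely
    (∀ (z : ℂ) (t : ℝ), t ≠ 0 → ∀ n : ℕ,
      Integrable (fun ζ : ℂ => oscWeight b z t ζ * conj (powA b z t n ζ)) ∧
      ∀ l : ℂ, Integrable (fun ζ : ℂ => oscWeight b z t ζ * conj (powA b z t n ζ) / (ζ - l))) ∧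
    -- (a)
    (∃ C T : ℝ, ∀ (t : ℝ) (z : ℂ), T ≤ |t| →
      ‖opB b z t (fun _ => 1)‖ ≤ C * (Real.log |t| / |t|)) ∧
    -- (b)
    (∃ C T : ℝ, ∀ (t : ℝ) (z : ℂ), T ≤ |t| →
      ‖opB b z t (opA b z t (fun _ => 1))‖ ≤ C * (Real.log |t| / |t|)) ∧
    (∃ β : ℝ, 0 < β ∧
      -- (c)
      (∀ (t : ℝ) (z l : ℂ), 1 ≤ |t| →
        ‖opA b z t (opA b z t (fun _ => 1)) l‖ ≤ β / |t| ^ ((1 : ℝ) / 14)) ∧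
      -- (d)
      (∀ (n : ℕ) (t : ℝ) (z l : ℂ), 2 ≤ n → 1 ≤ |t| →
        ‖powA b z t n l‖ ≤ β ^ (n - 1) / |t| ^ (((n / 2 : ℕ) : ℝ) / 14)) ∧
      -- (e)
      (∀ (n : ℕ) (t : ℝ) (z : ℂ), 2 ≤ n → 1 ≤ |t| →
        ‖opB b z t (powA b z t (n - 1))‖ ≤
          β ^ (n - 1) * Real.log (3 + |t|) / |t| ^ (1 + (((n - 2) / 2 : ℕ) : ℝ) / 14))) ∧
    -- uniform convergence of the Neumann series for large `|t|`
    (∃ T : ℝ, 1 ≤ T ∧ ∃ M : ℂ × ℝ × ℂ → ℂ,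
      TendstoUniformlyOn
        (fun (N : ℕ) (p : ℂ × ℝ × ℂ) => ∑ k ∈ Finset.range N,
          ((opA b p.1 p.2.1)^[2 * k] (fun l => 1 + opA b p.1 p.2.1 (fun _ => 1) l)) p.2.2)
        M atTop {p : ℂ × ℝ × ℂ | T ≤ |p.2.1|}) := by
  obtain ⟨CA, hCA0, hCA⟩ := exists_opA_bound hb
  obtain ⟨CB, hCB0, hCB⟩ := exists_opB_opA_bound hb
  obtain ⟨CD, hCD0, hCD⟩ := exists_opA_opA_bound hb
  obtain ⟨Co, hCo0, hCo⟩ := exists_oscillatory_bound hb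
  have one_meas : Measurable (fun _ : ℂ => (1 : ℂ)) := measurable_const
  have one_bd : ∀ ζ : ℂ, ‖(fun _ : ℂ => (1 : ℂ)) ζ‖ ≤ 1 := fun ζ => by simp
  have A1_meas : ∀ z t, Measurable (opA b z t fun _ => 1) := fun z t =>
    measurable_opA b z t one_meas
  have A1_bd : ∀ z t ζ, ‖opA b z t (fun _ => 1) ζ‖ ≤ CA := fun z t ζ => by
    simpa using (hCA z t _ one_meas 1 one_bd ζ).2
  have even : ∀ (z : ℂ) (t : ℝ), 1 ≤ |t| → ∀ f : ℂ → ℂ, Measurable f → ∀ M : ℝ,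
      (∀ ζ, ‖f ζ‖ ≤ M) → ∀ (k : ℕ) (ζ : ℂ),
      ‖(opA b z t)^[2 * k] f ζ‖ ≤ (CD / |t| ^ ((1 : ℝ) / 14)) ^ k * M :=
    fun z t ht f hf M hM k ζ => norm_iterate_even_le hb (hCD z t ht) hf hM k ζ
  have hrp : ∀ (t : ℝ) (k : ℕ), 1 ≤ |t| →
      (CD / |t| ^ ((1 : ℝ) / 14)) ^ k = CD ^ k / |t| ^ ((k : ℝ) / 14) := by
    intro t k ht
    rw [div_pow, ← Real.rpow_natCast (|t| ^ _), ← Real.rpow_mul (abs_nonneg t)]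
    congr 2
    ring
  -- A single `β` for all parts. Being at least `1`, it lets unused factors be absorbed into higher
  -- powers.
  set S : ℝ := 1 + CA + CB + CD with hS
  have hS1 : 1 ≤ S := by linarith
  have hSA : CA ≤ S := by linarith
  have hSB : CB ≤ S := by linarith
  have hSD : CD ≤ S := by linarith
  have powA_even : ∀ (m : ℕ) (t : ℝ) (z l : ℂ), 1 ≤ |t| →
      ‖powA b z t (2 * m) l‖ ≤ S ^ m / |t| ^ ((m : ℝ) / 14) := by
    intro m t z l ht
    have htp : 0 < |t| := by linarith
    have h := even z t ht _ one_meas 1 one_bd m l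
    rw [hrp t m ht, mul_one] at h
    exact h.trans (by gcongr)
  have powA_odd : ∀ (m : ℕ) (t : ℝ) (z l : ℂ), 1 ≤ |t| →
      ‖powA b z t (2 * m + 1) l‖ ≤ S ^ (m + 1) / |t| ^ ((m : ℝ) / 14) := by
    intro m t z l ht
    have htp : 0 < |t| := by linarith
    have h := even z t ht _ (A1_meas z t) CA (A1_bd z t) m l
    rw [hrp t m ht] at h
    -- An odd power is an even power applied to `A · 1`, which is only bounded: one extra constant,
    -- no extra decay.
    rw [powA, Function.iterate_succ_apply]
    refine h.trans ?_
    rw [div_mul_eq_mul_div, pow_succ]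
    gcongr
  have powA_meas : ∀ (n : ℕ) (z : ℂ) (t : ℝ),
      Measurable (powA b z t n) ∧ ∃ M : ℝ, ∀ ζ, ‖powA b z t n ζ‖ ≤ M := fun n z t =>
    measurable_bounded_iterate hb z t one_meas one_bd n
  refine ⟨fun z t _ n => ?_, ⟨2 * Co, 3, fun t z ht => ?_⟩, ⟨2 * CB, 3, fun t z ht => ?_⟩,
    ⟨S, by linarith, fun t z l ht => ?_, fun n t z l hn ht => ?_, fun n t z hn ht => ?_⟩, ?_⟩
  · obtain ⟨hm, M, hM⟩ := powA_meas n z t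
    exact ⟨integrable_opB_integrand hb z t hm hM, fun l => (hCA z t _ hm M hM l).1⟩
  · have htp : 0 < |t| := by linarith
    have h := hCo z t (by linarith) (fun _ => 1) (fun _ => 0) (fun _ => 0) 1 0
      (fun ζ => hasWirt_const 1 ζ) (by simp) (by simp) (by simp)
    have e : opB b z t (fun _ => 1) = ∫ ζ, oscWeight b z t ζ * 1 := by simp [opB]
    rw [e]
    calc _ ≤ Co * 1 * (Real.log (3 + |t|) / |t|) := h
      _ ≤ Co * 1 * (2 * Real.log |t| / |t|) := by
          gcongr; exact log_three_add_le_two_mul_log ht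
      _ = _ := by ring
  · have htp : 0 < |t| := by linarith
    calc _ ≤ CB * 1 * (Real.log (3 + |t|) / |t|) := hCB z t (by linarith) _ one_meas 1 one_bd
      _ ≤ CB * 1 * (2 * Real.log |t| / |t|) := by
          gcongr; exact log_three_add_le_two_mul_log ht
      _ = _ := by ring
  · have htp : 0 < |t| := by linarith
    have h := hCD z t ht _ one_meas 1 one_bd l
    rw [mul_one] at h
    exact h.trans (by gcongr)
  · have htp : 0 < |t| := by linarith
    rcases Nat.even_or_odd' n with ⟨m, rfl | rfl⟩
    · have e : 2 * m / 2 = m := by omega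
      rw [e]
      refine (powA_even m t z l ht).trans ?_
      gcongr ?_ / _
      exact pow_le_pow_right₀ hS1 (by omega)
    · have e : (2 * m + 1) / 2 = m := by omega
      rw [e]
      refine (powA_odd m t z l ht).trans ?_
      gcongr ?_ / _
      exact pow_le_pow_right₀ hS1 (by omega)
  · have htp : 0 < |t| := by linarith
    have hlog := one_le_log_three_add ht
    -- The outermost `B A` is estimated as one block, giving `log (3 + |t|) / |t|`; the inner
    -- `A^(n-2) · 1` supplies the remaining decay.
    have key : ∀ (m j : ℕ) (g : ℂ → ℂ), Measurable g →
        (∀ l, ‖g l‖ ≤ S ^ j / |t| ^ ((m : ℝ) / 14)) → j + 1 ≤ n - 1 →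
        ‖opB b z t (opA b z t g)‖ ≤
          S ^ (n - 1) * Real.log (3 + |t|) / |t| ^ (1 + (m : ℝ) / 14) := by
      intro m j g hg hgb hj
      refine (hCB z t ht g hg _ hgb).trans ?_
      rw [Real.rpow_add htp, Real.rpow_one]
      have hr : 0 < |t| ^ ((m : ℝ) / 14) := Real.rpow_pos_of_pos htp _
      calc _ = (CB * S ^ j) * Real.log (3 + |t|) / (|t| * |t| ^ ((m : ℝ) / 14)) := by
            field_simp
        _ ≤ S ^ (n - 1) * Real.log (3 + |t|) / (|t| * |t| ^ ((m : ℝ) / 14)) := by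
            gcongr
            calc CB * S ^ j ≤ S * S ^ j := by gcongr
              _ = S ^ (j + 1) := by ring
              _ ≤ _ := pow_le_pow_right₀ hS1 hj
    obtain ⟨k, rfl⟩ : ∃ k, n = k + 2 := ⟨n - 2, by omega⟩
    have e : powA b z t (k + 2 - 1) = opA b z t (powA b z t k) := by
      rw [powA, powA, ← Function.iterate_succ_apply' (opA b z t)]
      rfl
    have e2 : k + 2 - 2 = k := by omega
    rw [e, e2]
    rcases Nat.even_or_odd' k with ⟨m, rfl | rfl⟩
    · have e3 : 2 * m / 2 = m := by omega
      rw [e3]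
      exact key m m _ (powA_meas _ z t).1 (fun l => powA_even m t z l ht) (by omega)
    · have e3 : (2 * m + 1) / 2 = m := by omega
      rw [e3]
      exact key m (m + 1) _ (powA_meas _ z t).1 (fun l => powA_odd m t z l ht) (by omega)
  -- Beyond this `T` the operator `A²` has sup-norm bound at most `1/2`, so the series is dominated
  -- by a geometric one.
  · obtain ⟨T, hT1, hT⟩ : ∃ T : ℝ, 1 ≤ T ∧ 2 * CD ≤ T ^ ((1 : ℝ) / 14) := by
      have := (tendsto_rpow_atTop (y := (1 : ℝ) / 14) (by norm_num)).eventually_ge_atTop (2 * CD)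
      obtain ⟨T, h1, h2⟩ := ((eventually_ge_atTop (1 : ℝ)).and this).exists
      exact ⟨T, h1, h2⟩
    refine ⟨T, hT1, _, tendstoUniformlyOn_tsum_nat
      (u := fun k => (1 / 2 : ℝ) ^ k * (1 + CA))
      ((summable_geometric_of_lt_one (by norm_num) (by norm_num)).mul_right _) ?_⟩
    rintro k ⟨z, t, l⟩ ht
    have ht : T ≤ |t| := ht
    have htp : 0 < |t| := by linarith
    have h := even z t (hT1.trans ht) (fun l => 1 + opA b z t (fun _ => 1) l)
      ((A1_meas z t).const_add 1) (1 + CA)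
      (fun ζ => (norm_add_le _ _).trans (by
        rw [norm_one]
        exact add_le_add le_rfl (A1_bd z t ζ))) k l
    refine h.trans ?_
    have hq : CD / |t| ^ ((1 : ℝ) / 14) ≤ 1 / 2 := by
      rw [div_le_iff₀ (Real.rpow_pos_of_pos htp _)]
      have : T ^ ((1 : ℝ) / 14) ≤ |t| ^ ((1 : ℝ) / 14) := by gcongr
      linarith
    have hq0 : 0 ≤ CD / |t| ^ ((1 : ℝ) / 14) := by positivity
    gcongr
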